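/- All posets are finite. A poset is *automorphic* if it has an automorphism without fixed points, and *minimal automorphic* if moreover no proper retract of it is automorphic (a retract of $P$ is a subset $Q$ such that some order-preserving map $P\to Q$ fixes every element of $Q$). The *width* is the size of a largest antichain. A poset is *ranked* of rank $r\in\{0,1,2,\dots\}$ if each of its maximal chains has $r+1$ elements; the rank of an element $p$ is $\#C-1$, where $C$ is a longest chain in $\{q: q\le p\}$, and $P(i,j)$ is the subposet of the elements of rank between $i$ and $j$. The *ordinal sum* of a finite (possibly empty) sequence of posets is their disjoint union, with every element of an earlier summand below every element of a later one; $P+Q$ is the disjoint union without comparabilities between $P$ and $Q$. For $n\ge2$ the crown $C_{2n}$ has elements $x_0,\dots,x_{n-1},y_0,\dots,y_{n-1}$ and the strict comparabilities $x_0<y_0>x_1<y_1>\dots>x_{n-1}<y_{n-1}>x_0$ only. A *6-stack* is a ranked poset $P$ of some rank $n\ge 1$ such that $P(i,i+1)\cong C_6$ for $0\le i<n$. A *6-tower* is an ordinal sum of two-element antichains and 6-stacks. Consider posets with minimal elements $x_0,x_1,x_2,x_3$ and maximal elements $y_0,y_1,y_2,y_3$, each set drawn in a row from left to right. Write such a drawing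 as $[S_0\,|\,S_1\,|\,S_2\,|\,S_3]$, where $S_i$ is the set of all $j$ with $x_i<y_j$ (for instance, $01$ stands for $\{0,1\}$). We use the drawings - of $C_8$: $A_1=[01|12|23|03]$ and $A_2=[02|13|03|12]$; - of $C_4+C_4$: $B_1=[01|01|23|23]$, $B_2=[02|13|02|13]$ and $B_3=[02|13|13|02]$; - of $\bar K_{4,4}$ (the complete bipartite poset without a perfect matching): $K_1=[123|023|013|012]$ and $K_2=[012|013|023|123]$; - of $Z_1$: $D_1=[023|123|023|123]$ and $D_2=[023|123|123|023]$; - of its dual $Z_1^\partial$: $D_3=[02|13|0123|0123]$; - of $Z_2$: $E_1=[02|13|012|013]$ and $E_2=[02|13|013|012]$; - of $Z_3$: $G_3=[01|01|023|123]$; - of $Z_4$: $G_4=[01|01|0123|0123]$; - of $Z_5$: $G_5=[012|013|0123|0123]$; and these define $Z_1,\dots,Z_5$. An *8-stack* is a ranked poset $P$ of some rank $n\ge1$ such that, for $0\le i<n$, $P(i,i+1)$ is isomorphic to one of $C_8$, $C_4+C_4$, $\bar K_{4,4}$, $Z_1$, $Z_1^\partial$, $Z_2$, $Z_3$, $Z_4$,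 $Z_5$. It is *admissible* if there are a function $F:\{0,\dots,n\}\to\{(4),(2)(2)\}$ and, for each $i$, an ordering of the four elements of rank $i$ from left to right such that, for $0\le i<n$, the resulting drawing of $P(i,i+1)$, or its left-right mirror image (reverse both rows), is one of - $A_1,B_2,K_1$ if $F(i)=(4)$ and $F(i+1)=(4)$; - $B_2,D_1$ if $F(i)=(4)$ and $F(i+1)=(2)(2)$; - $B_2,B_3,D_3$ if $F(i)=(2)(2)$ and $F(i+1)=(4)$; - $A_2,B_1,B_2,B_3,K_2,D_1,D_2,D_3,E_1,E_2,G_3,G_4,G_5$ if $F(i)=(2)(2)$ and $F(i+1)=(2)(2)$. An *8-tower* is an ordinal sum of 6-towers and admissible 8-stacks. **Theorem.** Every ranked poset of width at most 4 that is minimal automorphic is an 8-tower; and every 8-tower is automorphic. -/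

import Mathlib

universe u v

/-! ### Automorphic posets, retracts, rank, width -/

/-- A poset is automorphic if it has a fixed-point-free automorphism. -/
def IsAutomorphic (P : Type u) [PartialOrder P] : Prop :=
  ∃ f : P ≃o P, ∀ p : P, f p ≠ p

/-- `Q` is a retract of `P`: some order-preserving map `P → Q` fixes every element of `Q`. -/
def IsRetract {P : Type u} [PartialOrder P] (Q : Set P) : Prop :=
  ∃ f : P →o Q, ∀ q : Q, f q = q

/-- An automorphic poset is minimal if no proper retract of it is automorphic. -/
def IsMinimalAutomorphic (P : Type u) [PartialOrder P] : Prop :=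
  IsAutomorphic P ∧ ∀ Q : Set P, IsRetract Q → Q ≠ Set.univ → ¬ IsAutomorphic Q

/-- Every maximal chain has rank `r`, that is, `r + 1` elements. -/
def IsRankedOfRank (P : Type u) [PartialOrder P] (r : ℕ) : Prop :=
  ∀ c : Set P, IsMaxChain (· ≤ ·) c → c.encard = r + 1

/-- A poset is ranked if it is ranked of rank `r` for some natural number `r`. -/
def IsRanked (P : Type u) [PartialOrder P] : Prop :=
  ∃ r : ℕ, IsRankedOfRank P r

/-- Every antichain has at most `w` elements. -/
def HasWidthAtMost (P : Type u) [PartialOrder P] (w : ℕ) : Prop :=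
  ∀ A : Set P, IsAntichain (· ≤ ·) A → A.encard ≤ w

/-- `P(i, j)`: the elements whose rank is between `i` and `j`. The rank of `p` is the height
of the poset of all elements `≤ p`, which is Mathlib's `Order.height p`. -/
def rankSegment (P : Type u) [PartialOrder P] (i j : ℕ) : Set P :=
  {p | (i : ℕ∞) ≤ Order.height p ∧ Order.height p ≤ (j : ℕ∞)}

/-- `P` is isomorphic to an ordinal sum `Q 0 ⊕ ⋯ ⊕ Q (k - 1)` (with `k ≥ 0` summands) of posets
satisfying `C`. Mathlib's order on `Σₗ i, Q i` is that of the ordinal sum. -/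
def IsOrdinalSumOf (C : (Q : Type u) → [PartialOrder Q] → Prop)
    (P : Type u) [PartialOrder P] : Prop :=
  ∃ (k : ℕ) (Q : Fin k → Type u) (_ : ∀ i, PartialOrder (Q i)),
    (∀ i, C (Q i)) ∧ Nonempty (P ≃o Σₗ i, Q i)

/-! ### Posets of rank one -/

/-- The poset with lower elements `x i` (`i : α`) and upper elements `y j` (`j : β`) in which the
only strict comparabilities are `x i < y j` for `R i j`. -/
def Bipartite {α : Type u} {β : Type v} (_R : α → β → Prop) : Type (max u v) := α ⊕ β

instance {α : Type u} {β : Type v} (R : α → β → Prop) : PartialOrder (Bipartite R) where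
  le a b := a = b ∨ ∃ i j, a = Sum.inl i ∧ b = Sum.inr j ∧ R i j
  le_refl _ := Or.inl rfl
  le_trans := by
    rintro a b c (rfl | ⟨i, j, rfl, rfl, h⟩) (rfl | ⟨i', j', h₁, rfl, h'⟩)
    · exact Or.inl rfl
    · exact Or.inr ⟨i', j', h₁, rfl, h'⟩
    · exact Or.inr ⟨i, j, rfl, rfl, h⟩
    · cases h₁
  le_antisymm := by
    rintro a b (rfl | ⟨i, j, rfl, rfl, h⟩) h'
    · rfl
    · rcases h' with h' | ⟨i', j', h₁, -, -⟩
      · exact h'.symm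
      · cases h₁

/-- The crown with `2 * n` elements: `x₀ < y₀ > x₁ < y₁ > ⋯ > xₙ₋₁ < yₙ₋₁ > x₀`. -/
abbrev Crown (n : ℕ) : Type :=
  Bipartite fun i j : Fin n => i = j ∨ (i : ℕ) = ((j : ℕ) + 1) % n

/-- A drawing of a poset of rank one with four minimal and four maximal elements, each placed at
the positions `0, 1, 2, 3` from left to right: `D i` is the set of the positions of the upper
covers of the `i`-th minimal element. -/
abbrev Diagram : Type := Fin 4 → Finset (Fin 4)

namespace Diagram

/-- The poset that is drawn. -/
abbrev Poset (D : Diagram) : Type := Bipartite fun i j : Fin 4 => j ∈ D i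

/-- The crown with 8 elements. -/
def crownA : Diagram := ![{0, 1}, {1, 2}, {2, 3}, {3, 0}]
def crownB : Diagram := ![{0, 2}, {1, 3}, {0, 3}, {1, 2}]

/-- Two disjoint crowns with 4 elements. -/
def twoCrownsA : Diagram := ![{0, 1}, {0, 1}, {2, 3}, {2, 3}]
def twoCrownsB : Diagram := ![{0, 2}, {1, 3}, {0, 2}, {1, 3}]
def twoCrownsC : Diagram := ![{0, 2}, {1, 3}, {1, 3}, {0, 2}]

/-- The almost-complete bipartite poset: all comparabilities but a perfect matching. -/
def almostCompleteA : Diagram := ![{1, 2, 3}, {0, 2, 3}, {0, 1, 3}, {0, 1, 2}]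
def almostCompleteB : Diagram := ![{0, 1, 2}, {0, 1, 3}, {0, 2, 3}, {1, 2, 3}]

/-- The poset `Z₁`. -/
def z₁A : Diagram := ![{0, 2, 3}, {1, 2, 3}, {0, 2, 3}, {1, 2, 3}]
def z₁B : Diagram := ![{0, 2, 3}, {1, 2, 3}, {1, 2, 3}, {0, 2, 3}]

/-- The dual of `Z₁`. -/
def z₁Dual : Diagram := ![{0, 2}, {1, 3}, {0, 1, 2, 3}, {0, 1, 2, 3}]

/-- The poset `Z₂`. -/
def z₂A : Diagram := ![{0, 2}, {1, 3}, {0, 1, 2}, {0, 1, 3}]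
def z₂B : Diagram := ![{0, 2}, {1, 3}, {0, 1, 3}, {0, 1, 2}]

/-- The poset `Z₃`. -/
def z₃ : Diagram := ![{0, 1}, {0, 1}, {0, 2, 3}, {1, 2, 3}]

/-- The poset `Z₄`. -/
def z₄ : Diagram := ![{0, 1}, {0, 1}, {0, 1, 2, 3}, {0, 1, 2, 3}]

/-- The poset `Z₅`. -/
def z₅ : Diagram := ![{0, 1, 2}, {0, 1, 3}, {0, 1, 2, 3}, {0, 1, 2, 3}]

end Diagram

/-- `Q` is isomorphic to `C₈`, `C₄ + C₄`, the almost-complete bipartite poset, `Z₁`, its dual,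
`Z₂`, `Z₃`, `Z₄` or `Z₅`. The sum of two posets carries the order without comparabilities between
the two summands. -/
def IsEightLayer (Q : Type u) [PartialOrder Q] : Prop :=
  Nonempty (Q ≃o Crown 4) ∨
  Nonempty (Q ≃o Crown 2 ⊕ Crown 2) ∨
  Nonempty (Q ≃o Bipartite fun i j : Fin 4 => i ≠ j) ∨
  Nonempty (Q ≃o Diagram.z₁A.Poset) ∨
  Nonempty (Q ≃o (Diagram.z₁A.Poset)ᵒᵈ) ∨
  Nonempty (Q ≃o Diagram.z₂A.Poset) ∨
  Nonempty (Q ≃o Diagram.z₃.Poset) ∨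
  Nonempty (Q ≃o Diagram.z₄.Poset) ∨
  Nonempty (Q ≃o Diagram.z₅.Poset)

/-! ### Towers and stacks -/

/-- A two-element antichain. -/
def IsTwoAntichain (Q : Type u) [PartialOrder Q] : Prop :=
  Nat.card Q = 2 ∧ IsAntichain (· ≤ ·) (Set.univ : Set Q)

/-- A 6-stack: a poset of rank `n ≥ 1` any two consecutive ranks of which form a 6-crown. -/
def IsSixStack (Q : Type u) [PartialOrder Q] : Prop :=
  ∃ n : ℕ, 1 ≤ n ∧ IsRankedOfRank Q n ∧
    ∀ i < n, Nonempty (rankSegment Q i (i + 1) ≃o Crown 3)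

/-- A 6-tower: an ordinal sum of two-element antichains and 6-stacks. -/
def IsSixTower (P : Type u) [PartialOrder P] : Prop :=
  IsOrdinalSumOf (fun Q _ => IsTwoAntichain Q ∨ IsSixStack Q) P

/-- An 8-stack of rank `n`. -/
def IsEightStack (Q : Type u) [PartialOrder Q] (n : ℕ) : Prop :=
  1 ≤ n ∧ IsRankedOfRank Q n ∧ ∀ i < n, IsEightLayer (rankSegment Q i (i + 1))

/-- The two labels `(4)` and `(2)(2)` of a rank with four elements. -/
inductive RankLabel : Type
  | four
  | twoTwo

/-- The diagrams allowed between two consecutive ranks, given the label of the lower and of the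
upper rank. -/
def allowedDiagrams : RankLabel → RankLabel → List Diagram
  | .four, .four => [.crownA, .twoCrownsB, .almostCompleteA]
  | .four, .twoTwo => [.twoCrownsB, .z₁A]
  | .twoTwo, .four => [.twoCrownsB, .twoCrownsC, .z₁Dual]
  | .twoTwo, .twoTwo =>
      [.crownB, .twoCrownsA, .twoCrownsB, .twoCrownsC, .almostCompleteB, .z₁A, .z₁B, .z₁Dual,
        .z₂A, .z₂B, .z₃, .z₄, .z₅]

/-- The four elements `x 0, …, x 3` of a rank and the four elements `y 0, …, y 3` of the next rank,
both listed from left to right, are drawn as in `D` or as in the left-right mirror image of `D`. -/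
def LooksLike {Q : Type u} [PartialOrder Q] (x y : Fin 4 → Q) (D : Diagram) : Prop :=
  (∀ a b : Fin 4, x a < y b ↔ b ∈ D a) ∨ (∀ a b : Fin 4, x a < y b ↔ b.rev ∈ D a.rev)

/-- An admissible 8-stack: there are labels `F i` of the ranks and a drawing of `Q` (`d i` lists the
elements of rank `i` from left to right) such that any two consecutive ranks look like one of the
diagrams allowed by their labels. -/
def IsAdmissibleEightStack (Q : Type u) [PartialOrder Q] : Prop :=
  ∃ n : ℕ, IsEightStack Q n ∧
    ∃ (F : Fin (n + 1) → RankLabel) (d : Fin (n + 1) → Fin 4 → Q),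
      (∀ i, Set.BijOn (d i) Set.univ {q | Order.height q = ((i : ℕ) : ℕ∞)}) ∧
      ∀ i : Fin n, ∃ D ∈ allowedDiagrams (F i.castSucc) (F i.succ),
        LooksLike (d i.castSucc) (d i.succ) D

/-- An 8-tower: an ordinal sum of 6-towers and admissible 8-stacks. -/
def IsEightTower (P : Type u) [PartialOrder P] : Prop :=
  IsOrdinalSumOf (fun Q _ => IsSixTower Q ∨ IsAdmissibleEightStack Q) P

/-! ### Graded posets -/

/-! Towers are automorphic because each label stands for a fixed-point-free permutation of the four
positions: `RankLabel.perm` is a 4-cycle for (4) and a product of two transpositions for (2)(2).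
Every allowed diagram is invariant under the permutations of its two labels
(`mem_perm_of_mem_allowedDiagrams`), so the permutations of the levels glue to an automorphism
(`IsGradedBy.isAutomorphic`). In a 6-stack a 3-cycle on each level does the same, and automorphisms
of the summands act together on an ordinal sum.

Conversely, let `P` be ranked and minimal automorphic of width at most 4, with fixed-point-free
automorphism `f`. If some element had a unique upper cover, all such elements of its rank could be
retracted onto their covers; they form an invariant set, so `f` would survive on the complement,
against minimality. Hence every element that is not maximal has two upper covers, and dually
(`exists_two_above`, `exists_two_below`).

Now split `P` at its cuts, the ranks that lie completely below the next rank. A single level between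
two cuts retracts onto two of its points, which can be swapped, so it has exactly two elements
(`ncard_eq_two_of_isCut`). A longer piece is a block (`IsBlock`). Its levels have two to four
elements. Size 2 is impossible, since two neighbours would be all neighbours. Sizes 3 and 4 cannot
be adjacent, since the fourth power of `f` fixes the 4-level pointwise and rotates the 3-level,
which makes the relation complete. So all levels have size 3, or all have size 4 (`ncard_eq`).

On a level, `f` is a 3-cycle, a 4-cycle or a product of two transpositions. The relation between
consecutive levels is invariant under `f`, so it is a union of few orbits of pairs, and a finite
check leaves only 6-crowns in size 3 and the allowed diagrams in size 4
(`isDrawable_of_perm_invariant`). Only the upper level has to be renumbered, by a permutation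
commuting with `f`, so the drawings can be chosen coherently from the bottom up. -/

theorem exists_forall_rk_le {α : Type*} (rk : α → ℕ) {C : Set α} (hC : C.Nonempty) :
    ∃ p ∈ C, ∀ q ∈ C, rk p ≤ rk q := by
  obtain ⟨p, hp, hmin⟩ := (InvImage.wf rk (wellFounded_lt (α := ℕ))).has_min C hC
  exact ⟨p, hp, fun q hq => not_lt.1 (hmin q hq)⟩

/-- All maximal chains of `Q` run through the ranks `0, …, n` of the function `rk`. -/
structure IsGradedBy (Q : Type u) [PartialOrder Q] (n : ℕ) (rk : Q → ℕ) : Prop where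
  lt_of_lt : ∀ {p q : Q}, p < q → rk p < rk q
  le : ∀ p, rk p ≤ n
  exists_between : ∀ {p q : Q}, p < q → ∃ z, p < z ∧ z ≤ q ∧ rk z = rk p + 1
  exists_gt : ∀ {p : Q}, rk p < n → ∃ z, p < z ∧ rk z = rk p + 1
  exists_lt : ∀ {p : Q}, 0 < rk p → ∃ z, z < p ∧ rk z + 1 = rk p

namespace IsGradedBy

variable {Q : Type u} [PartialOrder Q] {n : ℕ} {rk : Q → ℕ}

theorem le_of_le (h : IsGradedBy Q n rk) {p q : Q} (hpq : p ≤ q) : rk p ≤ rk q := by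
  rcases hpq.eq_or_lt with rfl | hpq
  · exact le_rfl
  · exact (h.lt_of_lt hpq).le

theorem eq_of_le (h : IsGradedBy Q n rk) {p q : Q} (hpq : p ≤ q) (hr : rk q ≤ rk p) : p = q := by
  rcases hpq.eq_or_lt with rfl | hpq
  · rfl
  · exact absurd (h.lt_of_lt hpq) (by omega)

/-- Climbing from `p` one rank at a time ends just below `q`; the order dual of the field
`exists_between` therefore need not be assumed. -/
theorem exists_between' (h : IsGradedBy Q n rk) {p q : Q} (hpq : p < q) :
    ∃ z, p ≤ z ∧ z < q ∧ rk z + 1 = rk q := by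
  obtain ⟨m, hm⟩ : ∃ m, rk q = rk p + m + 1 := ⟨rk q - rk p - 1, by have := h.lt_of_lt hpq; omega⟩
  induction m generalizing p with
  | zero => exact ⟨p, le_rfl, hpq, by omega⟩
  | succ m ih =>
    obtain ⟨z, hpz, hzq, hz⟩ := h.exists_between hpq
    have hzq' : z < q := hzq.lt_of_ne (by rintro rfl; omega)
    obtain ⟨w, hzw, hwq, hw⟩ := ih hzq' (by omega)
    exact ⟨w, hpz.le.trans hzw, hwq, hw⟩

theorem exists_ge (h : IsGradedBy Q n rk) {p : Q} {j : ℕ} (hj : rk p ≤ j) (hjn : j ≤ n) :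
    ∃ z, p ≤ z ∧ rk z = j := by
  induction j, hj using Nat.le_induction with
  | base => exact ⟨p, le_rfl, rfl⟩
  | succ j _ ih =>
    obtain ⟨z, hpz, hz⟩ := ih (by omega)
    obtain ⟨w, hzw, hw⟩ := h.exists_gt (p := z) (by omega)
    exact ⟨w, hpz.trans hzw.le, by omega⟩

theorem exists_le (h : IsGradedBy Q n rk) {p : Q} {j : ℕ} (hj : j ≤ rk p) :
    ∃ z, z ≤ p ∧ rk z = j := by
  obtain ⟨m, hm⟩ : ∃ m, rk p = j + m := ⟨rk p - j, by omega⟩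
  induction m generalizing p with
  | zero => exact ⟨p, le_rfl, hm⟩
  | succ m ih =>
    obtain ⟨z, hzp, hz⟩ := h.exists_lt (p := p) (by omega)
    obtain ⟨w, hwz, hw⟩ := ih (p := z) (by omega) (by omega)
    exact ⟨w, hwz.trans hzp.le, hw⟩

theorem exists_rk_eq (h : IsGradedBy Q n rk) [Nonempty Q] {j : ℕ} (hj : j ≤ n) :
    ∃ z, rk z = j := by
  obtain ⟨p⟩ := ‹Nonempty Q›
  obtain ⟨q, -, hq⟩ := h.exists_ge (h.le p) le_rfl
  obtain ⟨z, -, hz⟩ := h.exists_le (p := q) (j := j) (by omega)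
  exact ⟨z, hz⟩

theorem height_eq (h : IsGradedBy Q n rk) (p : Q) : Order.height p = rk p := by
  obtain ⟨m, hm⟩ : ∃ m, rk p = m := ⟨_, rfl⟩
  induction m using Nat.strong_induction_on generalizing p with
  | _ m ih =>
    subst hm
    apply le_antisymm
    · rw [Order.height_le_coe_iff]
      intro y hy
      rw [ih _ (h.lt_of_lt hy) y rfl]
      exact_mod_cast h.lt_of_lt hy
    · rcases Nat.eq_zero_or_pos (rk p) with h0 | h0
      · simp [h0]
      · obtain ⟨z, hzp, hz⟩ := h.exists_lt h0
        have := Order.height_add_one_le hzp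
        rw [ih _ (by omega) z rfl] at this
        rw [← hz]
        exact_mod_cast this

theorem apply_orderIso (h : IsGradedBy Q n rk) (f : Q ≃o Q) (p : Q) : rk (f p) = rk p := by
  have := Order.height_orderIso f p
  rw [h.height_eq, h.height_eq] at this
  exact_mod_cast this

theorem exists_mem_maxChain (h : IsGradedBy Q n rk) [Nonempty Q] {C : Set Q}
    (hC : IsMaxChain (· ≤ ·) C) {i : ℕ} (hi : i ≤ n) : ∃ p ∈ C, rk p = i := by
  -- An element comparable with all of `C` belongs to `C`. Each case below produces such an element
  -- of the missing rank.
  have hmax : ∀ z, (∀ p ∈ C, z ≤ p ∨ p ≤ z) → z ∈ C := by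
    intro z hz
    have : IsChain (· ≤ ·) (insert z C) := hC.1.insert fun b hb _ => hz b hb
    rw [hC.2 this (Set.subset_insert _ _)]
    exact Set.mem_insert _ _
  have hcmp : ∀ p ∈ C, ∀ q ∈ C, p ≤ q ∨ q ≤ p := fun p hp q hq => hC.1.total hp hq
  have hne : C.Nonempty := by
    rw [Set.nonempty_iff_ne_empty]
    rintro rfl
    obtain ⟨p⟩ := ‹Nonempty Q›
    exact hmax p (by simp)
  induction i with
  | zero =>
    obtain ⟨p, hp, hmin⟩ := exists_forall_rk_le rk hne
    refine ⟨p, hp, ?_⟩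
    by_contra h0
    obtain ⟨z, hzp, hz⟩ := h.exists_lt (Nat.pos_of_ne_zero h0)
    have hzC := hmax z fun q hq => by
      rcases hcmp p hp q hq with hpq | hqp
      · exact Or.inl (hzp.le.trans hpq)
      · rw [h.eq_of_le hqp (hmin q hq)]
        exact Or.inl hzp.le
    have := hmin z hzC
    omega
  | succ i ih =>
    obtain ⟨p, hp, hpi⟩ := ih (by omega)
    by_cases hup : {q ∈ C | i < rk q}.Nonempty
    · obtain ⟨q, ⟨hq, hiq⟩, hmin⟩ := exists_forall_rk_le rk hup
      have hpq : p < q := by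
        rcases hcmp p hp q hq with hpq | hqp
        · exact hpq.lt_of_ne (by rintro rfl; omega)
        · exact absurd (h.le_of_le hqp) (by omega)
      obtain ⟨z, hpz, hzq, hz⟩ := h.exists_between hpq
      refine ⟨z, hmax z fun w hw => ?_, by omega⟩
      by_cases hwi : i < rk w
      · rcases hcmp q hq w hw with hqw | hwq
        · exact Or.inl (hzq.trans hqw)
        · rw [h.eq_of_le hwq (hmin w ⟨hw, hwi⟩)]
          exact Or.inl hzq
      · rcases hcmp p hp w hw with hpw | hwp
        · rw [← h.eq_of_le hpw (by omega)]
          exact Or.inr hpz.le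
        · exact Or.inr (hwp.trans hpz.le)
    · obtain ⟨z, hpz, hz⟩ := h.exists_gt (p := p) (by omega)
      refine ⟨z, hmax z fun w hw => ?_, by omega⟩
      have hwi : ¬ i < rk w := fun hwi => hup ⟨w, hw, hwi⟩
      rcases hcmp p hp w hw with hpw | hwp
      · rw [← h.eq_of_le hpw (by omega)]
        exact Or.inr hpz.le
      · exact Or.inr (hwp.trans hpz.le)

theorem isRankedOfRank (h : IsGradedBy Q n rk) [Nonempty Q] : IsRankedOfRank Q n := by
  intro C hC
  have hinj : Set.InjOn rk C := by
    intro p hp q hq hpq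
    rcases hC.1.total hp hq with hle | hle
    · exact h.eq_of_le hle hpq.ge
    · exact (h.eq_of_le hle hpq.le).symm
  have himg : rk '' C = Set.Iic n := by
    ext i
    constructor
    · rintro ⟨p, -, rfl⟩
      exact h.le p
    · exact fun hi => h.exists_mem_maxChain hC hi
  rw [← hinj.encard_image, himg]
  have : (Set.Iic n) = ((Finset.range (n + 1) : Finset ℕ) : Set ℕ) := by ext; simp
  rw [this, Set.encard_coe_eq_coe_finsetCard, Finset.card_range]
  rfl

end IsGradedBy

/-! ### Ranked posets are graded by height -/

theorem IsRankedOfRank.nonempty {P : Type u} [PartialOrder P] {r : ℕ} (h : IsRankedOfRank P r) :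
    Nonempty P := by
  obtain ⟨M, hM, -⟩ := (Set.subsingleton_empty (α := P)).isChain (r := (· ≤ ·)) |>.exists_maxChain
  by_contra hP
  rw [not_nonempty_iff] at hP
  have := h M hM
  rw [Set.eq_empty_of_isEmpty M, Set.encard_empty] at this
  exact absurd this.symm (by norm_cast)

/-- On a maximal chain the height is injective with values at most `r`; as the chain has `r + 1`
elements, every rank occurs on it. The gradedness conditions are read off from a maximal chain
through the given elements. -/
theorem IsRankedOfRank.isGradedBy {P : Type u} [PartialOrder P] {r : ℕ} (h : IsRankedOfRank P r) :
    IsGradedBy P r fun p => (Order.height p).toNat := by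
  have hle : ∀ p : P, Order.height p ≤ r := by
    intro p
    refine Order.height_le fun s _ => ?_
    have hch : IsChain (· ≤ ·) (Set.range s.toFun) := by
      rintro _ ⟨i, rfl⟩ _ ⟨j, rfl⟩ _
      rcases le_total i j with hij | hij
      · exact Or.inl (s.monotone hij)
      · exact Or.inr (s.monotone hij)
    obtain ⟨M, hM, hsub⟩ := hch.exists_maxChain
    have h1 := Set.encard_le_encard hsub
    rw [h M hM, ← Set.image_univ, s.strictMono.injective.encard_image] at h1
    simp only [Set.encard_univ, ENat.card_eq_coe_fintype_card, Fintype.card_fin] at h1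
    have h2 : s.length + 1 ≤ r + 1 := by exact_mod_cast h1
    exact_mod_cast Nat.le_of_succ_le_succ h2
  -- `toNat` would send `⊤` to 0; the bound `hle` excludes this without finiteness of `P`.
  have hfin : ∀ p : P, ((Order.height p).toNat : ℕ∞) = Order.height p := fun p =>
    ENat.natCast_toNat (ne_top_of_le_ne_top (ENat.natCast_ne_top r) (hle p))
  set rk : P → ℕ := fun p => (Order.height p).toNat with hrk
  have hlt : ∀ {p q : P}, p < q → rk p < rk q := by
    intro p q hpq
    have h1 := Order.height_add_one_le hpq
    rw [← hfin p, ← hfin q] at h1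
    exact_mod_cast h1
  have hrle : ∀ p, rk p ≤ r := fun p => by
    have := hle p
    rw [← hfin p] at this
    exact_mod_cast this
  have key : ∀ c : Set P, IsChain (· ≤ ·) c → ∃ M, IsChain (· ≤ ·) M ∧ c ⊆ M ∧
      ∀ i ≤ r, ∃ z ∈ M, rk z = i := by
    intro c hc
    obtain ⟨M, hM, hcM⟩ := hc.exists_maxChain
    refine ⟨M, hM.1, hcM, ?_⟩
    have hinj : Set.InjOn rk M := by
      intro p hp q hq hpq
      by_contra hne
      rcases hM.1 hp hq hne with hle | hle
      · exact absurd (hlt (lt_of_le_of_ne hle hne)) (by omega)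
      · exact absurd (hlt (lt_of_le_of_ne hle (Ne.symm hne))) (by omega)
    have hMfin : M.Finite := Set.finite_of_encard_le_coe (k := r + 1) (by rw [h M hM]; norm_cast)
    have hcard : (hMfin.toFinset.image rk).card = r + 1 := by
      rw [Finset.card_image_of_injOn (by simpa using hinj)]
      have := h M hM
      rw [hMfin.encard_eq_coe_toFinset_card] at this
      exact_mod_cast this
    have himg : hMfin.toFinset.image rk = Finset.range (r + 1) := by
      apply Finset.eq_of_subset_of_card_le
      · intro i hi
        simp only [Finset.mem_image, Set.Finite.mem_toFinset] at hi
        obtain ⟨p, -, rfl⟩ := hi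
        simpa using Nat.lt_succ_of_le (hrle p)
      · simp [hcard]
    intro i hi
    have : i ∈ hMfin.toFinset.image rk := by rw [himg]; simpa using Nat.lt_succ_of_le hi
    simpa using this
  have hcmp : ∀ {M : Set P}, IsChain (· ≤ ·) M → ∀ {p q}, p ∈ M → q ∈ M → rk p < rk q → p < q := by
    intro M hM p q hp hq hpq
    rcases hM.total hp hq with hle | hle
    · exact lt_of_le_of_ne hle (by rintro rfl; omega)
    · rcases hle.eq_or_lt with rfl | hl
      · omega
      · exact absurd (hlt hl) (by omega)
  refine ⟨hlt, hrle, ?_, ?_, ?_⟩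
  · intro p q hpq
    obtain ⟨M, hM, hsub, hall⟩ := key {p, q} (IsChain.pair hpq.le)
    have hp : p ∈ M := hsub (by simp)
    have hq : q ∈ M := hsub (by simp)
    obtain ⟨z, hz, hzr⟩ := hall (rk p + 1) (by have := hlt hpq; have := hrle q; omega)
    refine ⟨z, hcmp hM hp hz (by omega), ?_, hzr⟩
    rcases hM.total hz hq with hle | hle
    · exact hle
    · rcases hle.eq_or_lt with rfl | hl
      · exact le_rfl
      · exact absurd (hlt hl) (by have := hlt hpq; omega)
  · intro p hp
    obtain ⟨M, hM, hsub, hall⟩ := key {p} (Set.subsingleton_singleton.isChain)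
    obtain ⟨z, hz, hzr⟩ := hall (rk p + 1) (by omega)
    exact ⟨z, hcmp hM (hsub rfl) hz (by omega), hzr⟩
  · intro p hp
    obtain ⟨M, hM, hsub, hall⟩ := key {p} (Set.subsingleton_singleton.isChain)
    obtain ⟨z, hz, hzr⟩ := hall (rk p - 1) (by have := hrle p; omega)
    exact ⟨z, hcmp hM hz (hsub rfl) (by omega), by omega⟩

/-- Finite dependent choice. The sequence is defined on all of `ℕ` and merely repeats itself from
index `n` on. -/
theorem exists_seq_of_forall_step {α : Type*} {n : ℕ} (p : ℕ → α → Prop) (r : ℕ → α → α → Prop)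
    (h0 : ∃ a, p 0 a) (hs : ∀ i < n, ∀ a, p i a → ∃ b, p (i + 1) b ∧ r i a b) :
    ∃ s : ℕ → α, (∀ i ≤ n, p i (s i)) ∧ ∀ i < n, r i (s i) (s (i + 1)) := by
  classical
  obtain ⟨a, ha⟩ := h0
  let s : ℕ → α := fun i => Nat.rec a
    (fun i b => if h : i < n ∧ p i b then (hs i h.1 b h.2).choose else b) i
  have hsucc : ∀ i (h : i < n ∧ p i (s i)), s (i + 1) = (hs i h.1 _ h.2).choose :=
    fun i h => dif_pos h
  have hp : ∀ i ≤ n, p i (s i) := by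
    intro i
    induction i with
    | zero => exact fun _ => ha
    | succ i ih =>
      intro hi
      have h : i < n ∧ p i (s i) := ⟨by omega, ih (by omega)⟩
      rw [hsucc i h]
      exact (hs i h.1 _ h.2).choose_spec.1
  refine ⟨s, hp, fun i hi => ?_⟩
  have h : i < n ∧ p i (s i) := ⟨hi, hp i hi.le⟩
  rw [hsucc i h]
  exact (hs i h.1 _ h.2).choose_spec.2

/-! ### Towers are automorphic -/

theorem IsGradedBy.strictMono_of_step {Q : Type u} [PartialOrder Q] {n : ℕ} {rk : Q → ℕ}
    (h : IsGradedBy Q n rk) {g : Q → Q}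
    (hg : ∀ p q, p < q → rk q = rk p + 1 → g p < g q) : StrictMono g := by
  intro p q hpq
  obtain ⟨m, hm⟩ : ∃ m, rk q = rk p + m + 1 := ⟨rk q - rk p - 1, by have := h.lt_of_lt hpq; omega⟩
  induction m generalizing p with
  | zero => exact hg p q hpq (by omega)
  | succ m ih =>
    obtain ⟨z, hpz, hzq, hz⟩ := h.exists_between hpq
    exact (hg p z hpz hz).trans (ih (hzq.lt_of_ne (by rintro rfl; omega)) (by omega))

/-- Fixed-point-free permutations of the levels that are compatible with the relations between
consecutive levels form a fixed-point-free automorphism. -/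
theorem IsGradedBy.isAutomorphic {Q : Type u} [PartialOrder Q] {n k : ℕ} {rk : Q → ℕ}
    (h : IsGradedBy Q n rk) (d : ℕ → Fin k → Q) (σ : ℕ → Equiv.Perm (Fin k))
    (hd : ∀ i ≤ n, Set.BijOn (d i) Set.univ {q | rk q = i}) (hσ : ∀ i a, σ i a ≠ a)
    (hrel : ∀ i < n, ∀ a b, d i a < d (i + 1) b ↔ d i (σ i a) < d (i + 1) (σ (i + 1) b)) :
    IsAutomorphic Q := by
  have hrk : ∀ i ≤ n, ∀ a, rk (d i a) = i := fun i hi a => (hd i hi).mapsTo (Set.mem_univ a)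
  choose idx hidx using fun p : Q =>
    (((hd (rk p) (h.le p)).surjOn (show p ∈ {q | rk q = rk p} from rfl)).imp fun a ha => ha.2)
  have hinj : ∀ i ≤ n, Function.Injective (d i) := fun i hi => Set.injOn_univ.1 (hd i hi).injOn
  have hidx' : ∀ i (_ : i ≤ n) a, idx (d i a) = a := by
    intro i hi a
    have := hidx (d i a)
    rw [hrk i hi a] at this
    exact hinj i hi this
  -- An arbitrary family `τ` is allowed so that `σ` and its levelwise inverse are handled by the
  -- same monotonicity argument.
  let G : (ℕ → Equiv.Perm (Fin k)) → Q → Q := fun τ p => d (rk p) (τ (rk p) (idx p))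
  have hGd : ∀ τ i, i ≤ n → ∀ a, G τ (d i a) = d i (τ i a) := by
    intro τ i hi a
    simp only [G, hrk i hi, hidx' i hi]
  have hmono : ∀ τ : ℕ → Equiv.Perm (Fin k), (∀ i < n, ∀ a b, d i a < d (i + 1) b →
      d i (τ i a) < d (i + 1) (τ (i + 1) b)) → StrictMono (G τ) := by
    intro τ hτ
    refine h.strictMono_of_step fun p q hpq hr => ?_
    have hn : rk p < n := by have := h.le q; omega
    rw [← hidx p, ← hidx q, hr] at hpq ⊢
    rw [hGd _ _ hn.le, hGd _ _ hn]
    exact hτ _ hn _ _ hpq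
  have h1 : StrictMono (G σ) := hmono _ fun i hi a b => (hrel i hi a b).1
  have h2 : StrictMono (G fun i => (σ i).symm) := hmono (fun i => (σ i).symm) fun i hi a b hab => by
    rw [hrel i hi]
    simpa only [Equiv.apply_symm_apply] using hab
  let e : Q ≃ Q :=
    { toFun := G σ
      invFun := G fun i => (σ i).symm
      left_inv := fun p => by
        obtain ⟨i, hi, a, rfl⟩ : ∃ i ≤ n, ∃ a, d i a = p := ⟨_, h.le p, _, hidx p⟩
        simp only [hGd _ i hi, Equiv.symm_apply_apply]
      right_inv := fun p => by
        obtain ⟨i, hi, a, rfl⟩ : ∃ i ≤ n, ∃ a, d i a = p := ⟨_, h.le p, _, hidx p⟩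
        simp only [hGd _ i hi, Equiv.apply_symm_apply] }
  refine ⟨e.toOrderIso h1.monotone h2.monotone, fun p hp => ?_⟩
  have hp' : G σ p = p := hp
  rw [← hidx p, hGd _ _ (h.le p)] at hp'
  exact hσ _ _ (hinj _ (h.le p) hp')

theorem IsAutomorphic.of_orderIso {P : Type u} {Q : Type v} [PartialOrder P] [PartialOrder Q]
    (e : P ≃o Q) : IsAutomorphic Q → IsAutomorphic P := by
  rintro ⟨f, hf⟩
  refine ⟨(e.trans f).trans e.symm, fun p hp => hf (e p) ?_⟩
  exact e.symm.injective (by simpa using hp)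

theorem IsOrdinalSumOf.isAutomorphic {C : (Q : Type u) → [PartialOrder Q] → Prop} {P : Type u}
    [PartialOrder P] (hP : IsOrdinalSumOf C P)
    (hC : ∀ (Q : Type u) [PartialOrder Q], C Q → IsAutomorphic Q) : IsAutomorphic P := by
  obtain ⟨k, Q, _, hQ, ⟨e⟩⟩ := hP
  refine IsAutomorphic.of_orderIso e ?_
  choose f hf using fun i => hC (Q i) (hQ i)
  have hmono : ∀ g : ∀ i, Q i ≃o Q i,
      Monotone fun x : Σₗ i, Q i => (toLex ⟨(ofLex x).1, g _ (ofLex x).2⟩ : Σₗ i, Q i) := by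
    rintro g ⟨i, a⟩ ⟨j, b⟩ hab
    rcases Sigma.lex_iff.1 hab with hij | ⟨hij, hab⟩
    · exact Sigma.Lex.left _ _ hij
    · obtain rfl : i = j := hij
      exact Sigma.Lex.right _ _ ((g i).monotone hab)
  let E : (Σₗ i, Q i) ≃ (Σₗ i, Q i) :=
    { toFun := fun x => toLex ⟨(ofLex x).1, f _ (ofLex x).2⟩
      invFun := fun x => toLex ⟨(ofLex x).1, (f _).symm (ofLex x).2⟩
      left_inv := fun x => congrArg (fun q => (⟨x.1, q⟩ : Σ i, Q i)) ((f x.1).symm_apply_apply x.2)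
      right_inv := fun x => congrArg (fun q => (⟨x.1, q⟩ : Σ i, Q i)) ((f x.1).apply_symm_apply x.2) }
  refine ⟨E.toOrderIso (hmono f) (hmono fun i => (f i).symm), ?_⟩
  rintro ⟨i, a⟩ hx
  have hx' : (⟨i, f i a⟩ : Σ i, Q i) = ⟨i, a⟩ := hx
  exact hf i a (by simpa using hx')

theorem IsTwoAntichain.isAutomorphic {Q : Type u} [PartialOrder Q] (h : IsTwoAntichain Q) :
    IsAutomorphic Q := by
  obtain ⟨hc, ha⟩ := h
  obtain ⟨a, b, hab, huniv⟩ := Nat.card_eq_two_iff.1 hc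
  have hle : ∀ {x y : Q}, x ≤ y → x = y := fun {x y} hxy => by
    by_contra hne
    exact ha (Set.mem_univ x) (Set.mem_univ y) hne hxy
  classical
  refine ⟨(Equiv.swap a b).toOrderIso (fun x y hxy => (congrArg _ (hle hxy)).le)
    (fun x y hxy => (congrArg _ (hle hxy)).le), fun x => ?_⟩
  have hx : x ∈ ({a, b} : Set Q) := huniv ▸ Set.mem_univ x
  rcases hx with rfl | rfl
  · exact (Equiv.swap_apply_left x b).trans_ne hab.symm
  · exact (Equiv.swap_apply_right a x).trans_ne hab

/-! ### Reading off and renumbering layers of rank one -/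

namespace Bipartite

/-- The lower elements. -/
def lower {α : Type u} {β : Type v} (R : α → β → Prop) (a : α) : Bipartite R := Sum.inl a

/-- The upper elements. -/
def upper {α : Type u} {β : Type v} (R : α → β → Prop) (b : β) : Bipartite R := Sum.inr b

theorem lower_injective {α : Type u} {β : Type v} (R : α → β → Prop) :
    Function.Injective (lower R) := Sum.inl_injective

theorem upper_injective {α : Type u} {β : Type v} (R : α → β → Prop) :
    Function.Injective (upper R) := Sum.inr_injective

theorem lt_iff {α : Type u} {β : Type v} {R : α → β → Prop} {s t : Bipartite R} :
    s < t ↔ ∃ i j, s = lower R i ∧ t = upper R j ∧ R i j := by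
  constructor
  · intro h
    rcases h.le with rfl | h'
    · exact absurd h (lt_irrefl _)
    · exact h'
  · rintro ⟨i, j, rfl, rfl, h⟩
    refine lt_of_le_of_ne (Or.inr ⟨i, j, rfl, rfl, h⟩) fun h => ?_
    cases h

theorem lower_lt_upper {α : Type u} {β : Type v} {R : α → β → Prop} {i : α} {j : β} :
    lower R i < upper R j ↔ R i j := by
  rw [lt_iff]
  constructor
  · rintro ⟨i', j', h1, h2, h⟩
    obtain rfl := lower_injective R h1
    obtain rfl := upper_injective R h2
    exact h
  · exact fun h => ⟨i, j, rfl, rfl, h⟩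

end Bipartite

/-- The isomorphism type of two consecutive levels can be read off in terms of enumerations of
these levels. -/
theorem exists_enum_of_rankSegment {Q : Type u} [PartialOrder Q] {n : ℕ} {rk : Q → ℕ}
    (h : IsGradedBy Q n rk) {i : ℕ} {α β : Type} {R : α → β → Prop}
    (e : rankSegment Q i (i + 1) ≃o Bipartite R) (hl : ∀ a, ∃ b, R a b) (hr : ∀ b, ∃ a, R a b) :
    ∃ (x : α → Q) (y : β → Q), Set.BijOn x Set.univ {q | rk q = i} ∧
      Set.BijOn y Set.univ {q | rk q = i + 1} ∧ ∀ a b, x a < y b ↔ R a b := by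
  have hmem : ∀ q : Q, q ∈ rankSegment Q i (i + 1) ↔ i ≤ rk q ∧ rk q ≤ i + 1 := by
    intro q
    simp only [rankSegment, Set.mem_ofPred_eq, h.height_eq]
    norm_cast
  let x : α → rankSegment Q i (i + 1) := fun a => e.symm (Bipartite.lower R a)
  let y : β → rankSegment Q i (i + 1) := fun b => e.symm (Bipartite.upper R b)
  have hxy : ∀ a b, (x a : Q) < y b ↔ R a b := by
    intro a b
    simp only [x, y, Subtype.coe_lt_coe, e.symm.lt_iff_lt, Bipartite.lower_lt_upper]
  -- An isolated element of the bipartite poset would not reveal its level; `hl` and `hr` supply a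
  -- comparable partner, and only two ranks are available.
  have hx : ∀ a, rk (x a : Q) = i := by
    intro a
    obtain ⟨b, hb⟩ := hl a
    have h1 := h.lt_of_lt ((hxy a b).2 hb)
    have h2 := (hmem _).1 (x a).2
    have h3 := (hmem _).1 (y b).2
    omega
  have hy : ∀ b, rk (y b : Q) = i + 1 := by
    intro b
    obtain ⟨a, ha⟩ := hr b
    have h1 := h.lt_of_lt ((hxy a b).2 ha)
    have h2 := (hmem _).1 (x a).2
    have h3 := (hmem _).1 (y b).2
    omega
  have hcase : ∀ q : rankSegment Q i (i + 1), (∃ a, q = x a) ∨ ∃ b, q = y b := by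
    intro q
    obtain ⟨s, rfl⟩ := e.symm.surjective q
    rcases s with a | b
    · exact Or.inl ⟨a, rfl⟩
    · exact Or.inr ⟨b, rfl⟩
  refine ⟨fun a => x a, fun b => y b, ⟨fun a _ => hx a, fun a _ a' _ haa => ?_, fun q hq => ?_⟩,
    ⟨fun b _ => hy b, fun b _ b' _ hbb => ?_, fun q hq => ?_⟩, hxy⟩
  · exact Bipartite.lower_injective R (e.symm.injective (Subtype.ext haa))
  · rcases hcase ⟨q, (hmem q).2 (by simp at hq; omega)⟩ with ⟨a, ha⟩ | ⟨b, hb⟩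
    · exact ⟨a, Set.mem_univ a, (congrArg Subtype.val ha).symm⟩
    · have := hy b
      rw [← hb] at this
      simp at hq this
      omega
  · exact Bipartite.upper_injective R (e.symm.injective (Subtype.ext hbb))
  · rcases hcase ⟨q, (hmem q).2 (by simp at hq; omega)⟩ with ⟨a, ha⟩ | ⟨b, hb⟩
    · have := hx a
      rw [← ha] at this
      simp at hq this
      omega
    · exact ⟨b, Set.mem_univ b, (congrArg Subtype.val hb).symm⟩

/-- An enumeration of a level can be reparametrized. -/
theorem bijOn_comp_perm {Q : Type u} {k : ℕ} {x : Fin k → Q} {s : Set Q}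
    (hx : Set.BijOn x Set.univ s) (π : Equiv.Perm (Fin k)) :
    Set.BijOn (fun a => x (π a)) Set.univ s :=
  hx.comp (Set.bijOn_univ.2 π.bijective)

/-- The 6-crown is the complete bipartite poset minus a perfect matching. Numbering each level along
the matching turns every relation into `a ≠ b`, which is preserved by the same 3-cycle on all
levels. -/
theorem IsSixStack.isAutomorphic {Q : Type u} [PartialOrder Q] (hQ : IsSixStack Q) :
    IsAutomorphic Q := by
  obtain ⟨n, hn, hr, hseg⟩ := hQ
  have h := hr.isGradedBy
  set rk : Q → ℕ := fun p => (Order.height p).toNat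
  have hlay : ∀ i < n, ∃ x y : Fin 3 → Q, Set.BijOn x Set.univ {q | rk q = i} ∧
      Set.BijOn y Set.univ {q | rk q = i + 1} ∧
      ∀ a b : Fin 3, x a < y b ↔ (a = b ∨ (a : ℕ) = ((b : ℕ) + 1) % 3) := fun i hi => by
    obtain ⟨e⟩ := hseg i hi
    exact exists_enum_of_rankSegment h e (fun a => ⟨a, Or.inl rfl⟩) (fun a => ⟨a, Or.inl rfl⟩)
  obtain ⟨d, hd, hrel⟩ := exists_seq_of_forall_step (n := n)
    (fun i (x : Fin 3 → Q) => Set.BijOn x Set.univ {q | rk q = i})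
    (fun i x y => ∀ a b : Fin 3, x a < y b ↔ a ≠ b)
    (by obtain ⟨x, y, hx, -⟩ := hlay 0 (by omega); exact ⟨x, hx⟩)
    (by
      intro i hi d hd
      obtain ⟨x, y, hx, hy, hxy⟩ := hlay i hi
      choose π hπ using fun a =>
        ((hx.surjOn (hd.mapsTo (Set.mem_univ a))).imp fun a ha => ha.2)
      have hπi : Function.Injective π := fun a b hab =>
        Set.injOn_univ.1 hd.injOn (by rw [← hπ a, ← hπ b, hab])
      let ρ := Equiv.ofBijective π (Finite.injective_iff_bijective.1 hπi)
      -- In `Crown 3` the only upper element not above the lower element `s` is the one with index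
      -- `s + 1`, which explains the shift.
      refine ⟨_, bijOn_comp_perm hy (ρ.trans (Equiv.addRight 1)), fun a b => ?_⟩
      rw [← hπ a, hxy, ← hπi.ne_iff]
      change (π a = π b + 1 ∨ (π a : ℕ) = ((π b + 1 : Fin 3) + 1 : ℕ) % 3) ↔ π a ≠ π b
      generalize π a = s
      generalize π b = t
      revert s t
      decide)
  exact h.isAutomorphic d (fun _ => Equiv.addRight 1) hd (fun _ => by decide)
    fun i hi a b => by simp [hrel i hi]

namespace RankLabel

/-- The permutation of the positions `0, 1, 2, 3` that belongs to a label. -/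
def perm : RankLabel → Equiv.Perm (Fin 4)
  | .four => Equiv.addRight 1
  | .twoTwo => ⟨![1, 0, 3, 2], ![1, 0, 3, 2], by decide, by decide⟩

theorem perm_apply_ne (t : RankLabel) (a : Fin 4) : t.perm a ≠ a := by
  cases t <;> revert a <;> decide

end RankLabel

/-- Mirror images are invariant too, because reversal conjugates each label's permutation to its
inverse. -/
theorem mem_perm_of_mem_allowedDiagrams (s t : RankLabel) :
    ∀ D ∈ allowedDiagrams s t, ∀ a b : Fin 4,
      (b ∈ D a ↔ t.perm b ∈ D (s.perm a)) ∧
      (b.rev ∈ D a.rev ↔ (t.perm b).rev ∈ D (s.perm a).rev) := by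
  cases s <;> cases t <;>
    simp only [allowedDiagrams, List.forall_mem_cons, List.not_mem_nil, false_imp_iff,
      implies_true, and_true] <;>
    constructorm* _ ∧ _ <;> decide

theorem IsAdmissibleEightStack.isAutomorphic {Q : Type u} [PartialOrder Q]
    (hQ : IsAdmissibleEightStack Q) : IsAutomorphic Q := by
  obtain ⟨n, ⟨-, hr, -⟩, F, d, hd, hrel⟩ := hQ
  have h := hr.isGradedBy
  set rk : Q → ℕ := fun p => (Order.height p).toNat
  -- `Fin.ofNat` extends the families to all of `ℕ`; its reduction modulo `n + 1` changes nothing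
  -- for `i ≤ n`.
  refine h.isAutomorphic (fun i => d (Fin.ofNat _ i)) (fun i => (F (Fin.ofNat _ i)).perm)
    (fun i hi => ?_) (fun i a => RankLabel.perm_apply_ne _ a) (fun i hi a b => ?_)
  · convert hd (Fin.ofNat _ i) using 1
    ext q
    simp [h.height_eq, Nat.mod_eq_of_lt (Nat.lt_succ_of_le hi)]
  · obtain ⟨D, hD, hlook⟩ := hrel ⟨i, hi⟩
    have h1 : (Fin.ofNat (n + 1) i) = (⟨i, hi⟩ : Fin n).castSucc :=
      Fin.ext (Nat.mod_eq_of_lt (by omega))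
    have h2 : (Fin.ofNat (n + 1) (i + 1)) = (⟨i, hi⟩ : Fin n).succ :=
      Fin.ext (Nat.mod_eq_of_lt (by omega))
    rw [h1, h2]
    have hp := mem_perm_of_mem_allowedDiagrams _ _ D hD a b
    rcases hlook with hl | hl
    · rw [hl, hl]
      exact hp.1
    · rw [hl, hl]
      exact hp.2

theorem IsEightTower.isAutomorphic {P : Type u} [PartialOrder P] (hP : IsEightTower P) :
    IsAutomorphic P := by
  refine IsOrdinalSumOf.isAutomorphic hP fun Q _ hQ => ?_
  rcases hQ with hQ | hQ
  · refine IsOrdinalSumOf.isAutomorphic hQ fun Q _ hQ => ?_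
    rcases hQ with hQ | hQ
    · exact hQ.isAutomorphic
    · exact hQ.isAutomorphic
  · exact hQ.isAutomorphic

/-! ### Drawings of two consecutive levels with four elements -/

/-- A relation in which every element is related to at least two others. -/
def HasTwoNeighbours {α β : Type*} (R : α → β → Prop) : Prop :=
  (∀ a, ∃ b b', b ≠ b' ∧ R a b ∧ R a b') ∧ ∀ b, ∃ a a', a ≠ a' ∧ R a b ∧ R a' b

instance {k l : ℕ} (R : Fin k → Fin l → Bool) :
    Decidable (HasTwoNeighbours fun a b => R a b = true) :=
  inferInstanceAs (Decidable (_ ∧ _))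

namespace RankLabel

/-- Permutations of the positions that commute with the permutation of the label. -/
def relabelings : RankLabel → List (Fin 4 → Fin 4)
  | .four => [![0, 1, 2, 3], ![1, 2, 3, 0], ![2, 3, 0, 1], ![3, 0, 1, 2]]
  | .twoTwo => [![0, 1, 2, 3], ![1, 0, 2, 3], ![0, 1, 3, 2], ![1, 0, 3, 2], ![2, 3, 0, 1],
      ![3, 2, 0, 1], ![2, 3, 1, 0], ![3, 2, 1, 0]]

/-- The lists are the full centralizers, of orders 4 and 8. Commutation ensures that the
automorphism still acts as `t.perm` after renumbering. -/
theorem relabelings_spec (t : RankLabel) : ∀ π ∈ t.relabelings,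
    Function.Injective π ∧ ∀ b, π (t.perm b) = t.perm (π b) := by
  cases t <;>
    simp only [relabelings, List.forall_mem_cons, List.not_mem_nil, false_imp_iff,
      implies_true, and_true] <;>
    constructorm* _ ∧ _ <;> decide

end RankLabel

/-- Some relabeling of the upper level turns the relation `R` into an allowed diagram. -/
def isDrawable (s t : RankLabel) (R : Fin 4 → Fin 4 → Bool) : Bool :=
  t.relabelings.any fun π => (allowedDiagrams s t).any fun D =>
    decide (∀ a b, R a (π b) = decide (b ∈ D a)) ||
    decide (∀ a b, R a (π b) = decide (b.rev ∈ D a.rev))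

theorem exists_looksLike_of_isDrawable {Q : Type u} [PartialOrder Q] {s t : RankLabel}
    {x y : Fin 4 → Q} {R : Fin 4 → Fin 4 → Bool} (hR : isDrawable s t R = true)
    (hxy : ∀ a b, x a < y b ↔ R a b = true) :
    ∃ π ∈ t.relabelings, ∃ D ∈ allowedDiagrams s t, LooksLike x (fun b => y (π b)) D := by
  simp only [isDrawable, List.any_eq_true, Bool.or_eq_true, decide_eq_true_eq] at hR
  obtain ⟨π, hπ, D, hD, h | h⟩ := hR
  · exact ⟨π, hπ, D, hD, Or.inl fun a b => by rw [hxy, h]; simp⟩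
  · exact ⟨π, hπ, D, hD, Or.inr fun a b => by rw [hxy, h]; simp⟩

/-! ### Finite classification of the invariant relations -/

/-- The sixteen pairs of positions fall into four orbits if a 4-cycle is involved, and into eight if
both labels are (2)(2). One Boolean per orbit describes an invariant relation, so there are 16 or
256 cases. -/
theorem isDrawable_four_four : ∀ p q r s : Bool,
    let R : Fin 4 → Fin 4 → Bool := ![![p, q, r, s], ![s, p, q, r], ![r, s, p, q], ![q, r, s, p]]
    (HasTwoNeighbours fun a b => R a b = true) → (∃ a b, R a b = false) →
      isDrawable .four .four R = true := by
  decide +kernel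

theorem isDrawable_four_twoTwo : ∀ p q r s : Bool,
    let R : Fin 4 → Fin 4 → Bool := ![![p, q, r, s], ![q, p, s, r], ![p, q, r, s], ![q, p, s, r]]
    (HasTwoNeighbours fun a b => R a b = true) → (∃ a b, R a b = false) →
      isDrawable .four .twoTwo R = true := by
  decide +kernel

theorem isDrawable_twoTwo_four : ∀ p q r s : Bool,
    let R : Fin 4 → Fin 4 → Bool := ![![p, q, p, q], ![q, p, q, p], ![r, s, r, s], ![s, r, s, r]]
    (HasTwoNeighbours fun a b => R a b = true) → (∃ a b, R a b = false) →
      isDrawable .twoTwo .four R = true := by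
  decide +kernel

theorem isDrawable_twoTwo_twoTwo : ∀ p q r s t u v w : Bool,
    let R : Fin 4 → Fin 4 → Bool := ![![p, q, r, s], ![q, p, s, r], ![t, u, v, w], ![u, t, w, v]]
    (HasTwoNeighbours fun a b => R a b = true) → (∃ a b, R a b = false) →
      isDrawable .twoTwo .twoTwo R = true := by
  decide +kernel

/-- This is the origin of the list of allowed diagrams: up to renumbering the upper level and
reflection, it contains every invariant relation with two neighbours everywhere, except the complete
one. -/
theorem isDrawable_of_perm_invariant (s t : RankLabel) (R : Fin 4 → Fin 4 → Bool)
    (hR : ∀ a b, R (s.perm a) (t.perm b) = R a b) (h2 : HasTwoNeighbours fun a b => R a b = true)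
    (hnf : ∃ a b, R a b = false) : isDrawable s t R = true := by
  have hS : ∀ S : Fin 4 → Fin 4 → Bool, (∀ a b, R a b = S a b) → R = S := fun S h =>
    funext fun a => funext fun b => h a b
  cases s <;> cases t
  -- The sixteen instances of `hR` link the entries of each orbit, so that `R` becomes a table with
  -- one parameter per orbit.
  · have h : R 1 1 = R 0 0 ∧ R 1 2 = R 0 1 ∧ R 1 3 = R 0 2 ∧ R 1 0 = R 0 3 ∧ R 2 1 = R 1 0 ∧
      R 2 2 = R 1 1 ∧ R 2 3 = R 1 2 ∧ R 2 0 = R 1 3 ∧ R 3 1 = R 2 0 ∧ R 3 2 = R 2 1 ∧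
      R 3 3 = R 2 2 ∧ R 3 0 = R 2 3 ∧ R 0 1 = R 3 0 ∧ R 0 2 = R 3 1 ∧ R 0 3 = R 3 2 ∧
      R 0 0 = R 3 3 :=
      ⟨hR 0 0, hR 0 1, hR 0 2, hR 0 3, hR 1 0, hR 1 1, hR 1 2, hR 1 3, hR 2 0, hR 2 1, hR 2 2,
      hR 2 3, hR 3 0, hR 3 1, hR 3 2, hR 3 3⟩
    rw [hS ![![R 0 0, R 0 1, R 0 2, R 0 3], ![R 0 3, R 0 0, R 0 1, R 0 2],
      ![R 0 2, R 0 3, R 0 0, R 0 1], ![R 0 1, R 0 2, R 0 3, R 0 0]] (by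
        clear hR h2 hnf
        intro a b
        fin_cases a <;> fin_cases b <;> simp <;> grind)] at h2 hnf ⊢
    exact isDrawable_four_four _ _ _ _ h2 hnf
  · have h : R 1 1 = R 0 0 ∧ R 1 0 = R 0 1 ∧ R 1 3 = R 0 2 ∧ R 1 2 = R 0 3 ∧ R 2 1 = R 1 0 ∧
      R 2 0 = R 1 1 ∧ R 2 3 = R 1 2 ∧ R 2 2 = R 1 3 ∧ R 3 1 = R 2 0 ∧ R 3 0 = R 2 1 ∧
      R 3 3 = R 2 2 ∧ R 3 2 = R 2 3 ∧ R 0 1 = R 3 0 ∧ R 0 0 = R 3 1 ∧ R 0 3 = R 3 2 ∧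
      R 0 2 = R 3 3 :=
      ⟨hR 0 0, hR 0 1, hR 0 2, hR 0 3, hR 1 0, hR 1 1, hR 1 2, hR 1 3, hR 2 0, hR 2 1, hR 2 2,
      hR 2 3, hR 3 0, hR 3 1, hR 3 2, hR 3 3⟩
    rw [hS ![![R 0 0, R 0 1, R 0 2, R 0 3], ![R 0 1, R 0 0, R 0 3, R 0 2],
      ![R 0 0, R 0 1, R 0 2, R 0 3], ![R 0 1, R 0 0, R 0 3, R 0 2]] (by
        clear hR h2 hnf
        intro a b
        fin_cases a <;> fin_cases b <;> simp <;> grind)] at h2 hnf ⊢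
    exact isDrawable_four_twoTwo _ _ _ _ h2 hnf
  · have h : R 1 1 = R 0 0 ∧ R 1 2 = R 0 1 ∧ R 1 3 = R 0 2 ∧ R 1 0 = R 0 3 ∧ R 0 1 = R 1 0 ∧
      R 0 2 = R 1 1 ∧ R 0 3 = R 1 2 ∧ R 0 0 = R 1 3 ∧ R 3 1 = R 2 0 ∧ R 3 2 = R 2 1 ∧
      R 3 3 = R 2 2 ∧ R 3 0 = R 2 3 ∧ R 2 1 = R 3 0 ∧ R 2 2 = R 3 1 ∧ R 2 3 = R 3 2 ∧
      R 2 0 = R 3 3 :=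
      ⟨hR 0 0, hR 0 1, hR 0 2, hR 0 3, hR 1 0, hR 1 1, hR 1 2, hR 1 3, hR 2 0, hR 2 1, hR 2 2,
      hR 2 3, hR 3 0, hR 3 1, hR 3 2, hR 3 3⟩
    rw [hS ![![R 0 0, R 0 1, R 0 0, R 0 1], ![R 0 1, R 0 0, R 0 1, R 0 0],
      ![R 2 0, R 2 1, R 2 0, R 2 1], ![R 2 1, R 2 0, R 2 1, R 2 0]] (by
        clear hR h2 hnf
        intro a b
        fin_cases a <;> fin_cases b <;> simp <;> grind)] at h2 hnf ⊢
    exact isDrawable_twoTwo_four _ _ _ _ h2 hnf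
  · have h : R 1 1 = R 0 0 ∧ R 1 0 = R 0 1 ∧ R 1 3 = R 0 2 ∧ R 1 2 = R 0 3 ∧ R 0 1 = R 1 0 ∧
      R 0 0 = R 1 1 ∧ R 0 3 = R 1 2 ∧ R 0 2 = R 1 3 ∧ R 3 1 = R 2 0 ∧ R 3 0 = R 2 1 ∧
      R 3 3 = R 2 2 ∧ R 3 2 = R 2 3 ∧ R 2 1 = R 3 0 ∧ R 2 0 = R 3 1 ∧ R 2 3 = R 3 2 ∧
      R 2 2 = R 3 3 :=
      ⟨hR 0 0, hR 0 1, hR 0 2, hR 0 3, hR 1 0, hR 1 1, hR 1 2, hR 1 3, hR 2 0, hR 2 1, hR 2 2,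
      hR 2 3, hR 3 0, hR 3 1, hR 3 2, hR 3 3⟩
    rw [hS ![![R 0 0, R 0 1, R 0 2, R 0 3], ![R 0 1, R 0 0, R 0 3, R 0 2],
      ![R 2 0, R 2 1, R 2 2, R 2 3], ![R 2 1, R 2 0, R 2 3, R 2 2]] (by
        clear hR h2 hnf
        intro a b
        fin_cases a <;> fin_cases b <;> simp <;> grind)] at h2 hnf ⊢
    exact isDrawable_twoTwo_twoTwo _ _ _ _ _ _ _ _ h2 hnf

/-! ### Isomorphism types of two consecutive levels -/

namespace Bipartite

theorem lower_le_lower {α β : Type*} {R : α → β → Prop} {a a' : α} :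
    lower R a ≤ lower R a' ↔ a = a' := by
  constructor
  · rintro (h | ⟨_, _, _, h, _⟩)
    · exact lower_injective R h
    · cases h
  · rintro rfl
    exact le_rfl

theorem upper_le_upper {α β : Type*} {R : α → β → Prop} {b b' : β} :
    upper R b ≤ upper R b' ↔ b = b' := by
  constructor
  · rintro (h | ⟨_, _, h, _⟩)
    · exact upper_injective R h
    · cases h
  · rintro rfl
    exact le_rfl

theorem lower_le_upper {α β : Type*} {R : α → β → Prop} {a : α} {b : β} :
    lower R a ≤ upper R b ↔ R a b := by
  refine ⟨?_, fun h => (lower_lt_upper.2 h).le⟩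
  rintro (h | ⟨_, _, h, h', hR⟩)
  · cases h
  · cases h
    cases h'
    exact hR

theorem not_upper_le_lower {α β : Type*} {R : α → β → Prop} {a : α} {b : β} :
    ¬ upper R b ≤ lower R a := by
  rintro (h | ⟨_, _, h, _⟩) <;> cases h

/-- A poset is isomorphic to `Bipartite R` if its order is described by `R`. -/
theorem nonempty_orderIso_of_forall {α β T : Type*} [PartialOrder T] {R : α → β → Prop} {x : α → T}
    {y : β → T} (hxx : ∀ a a', x a ≤ x a' → a = a') (hyy : ∀ b b', y b ≤ y b' → b = b')
    (hxy : ∀ a b, x a ≤ y b ↔ R a b) (hyx : ∀ a b, ¬ y b ≤ x a)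
    (hT : ∀ t, (∃ a, x a = t) ∨ ∃ b, y b = t) : Nonempty (T ≃o Bipartite R) := by
  let φ : Bipartite R → T := Sum.elim x y
  have hφ : ∀ s t, φ s ≤ φ t ↔ s ≤ t := by
    intro s t
    rcases s with a | b <;> rcases t with a' | b'
    · refine Iff.trans ⟨hxx a a', ?_⟩ lower_le_lower.symm
      rintro rfl
      exact le_rfl
    · exact (hxy a b').trans lower_le_upper.symm
    · exact iff_of_false (hyx a' b) not_upper_le_lower
    · refine Iff.trans ⟨hyy b b', ?_⟩ upper_le_upper.symm
      rintro rfl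
      exact le_rfl
  have hinj : Function.Injective φ := fun s t hst =>
    le_antisymm ((hφ s t).1 hst.le) ((hφ t s).1 hst.ge)
  have hsurj : Function.Surjective φ := by
    intro t
    rcases hT t with ⟨a, ha⟩ | ⟨b, hb⟩
    · exact ⟨Sum.inl a, ha⟩
    · exact ⟨Sum.inr b, hb⟩
  exact ⟨OrderIso.symm ⟨Equiv.ofBijective φ ⟨hinj, hsurj⟩, fun {s t} => hφ s t⟩⟩

theorem eq_lower_or_eq_upper {α β : Type*} {R : α → β → Prop} (s : Bipartite R) :
    (∃ a, lower R a = s) ∨ ∃ b, upper R b = s := by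
  rcases s with a | b
  · exact Or.inl ⟨a, rfl⟩
  · exact Or.inr ⟨b, rfl⟩

theorem nonempty_orderIso {α β α' β' : Type*} {R : α → β → Prop} {R' : α' → β' → Prop}
    (e : α' ≃ α) (e' : β' ≃ β) (h : ∀ a b, R (e a) (e' b) ↔ R' a b) :
    Nonempty (Bipartite R ≃o Bipartite R') := by
  refine nonempty_orderIso_of_forall (x := fun a => lower R (e a)) (y := fun b => upper R (e' b))
    (fun a a' => by simp [lower_le_lower]) (fun b b' => by simp [upper_le_upper])
    (fun a b => by rw [lower_le_upper, h]) (fun a b => not_upper_le_lower) fun t => ?_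
  rcases eq_lower_or_eq_upper t with ⟨a, rfl⟩ | ⟨b, rfl⟩
  · exact Or.inl ⟨e.symm a, by simp⟩
  · exact Or.inr ⟨e'.symm b, by simp⟩

theorem nonempty_orderIso_dual {α β : Type*} {R : α → β → Prop} {R' : β → α → Prop}
    (h : ∀ a b, R a b ↔ R' b a) : Nonempty (Bipartite R ≃o (Bipartite R')ᵒᵈ) := by
  obtain ⟨e⟩ := nonempty_orderIso_of_forall (T := (Bipartite R')ᵒᵈ) (R := R)
    (x := fun a => OrderDual.toDual (upper R' a)) (y := fun b => OrderDual.toDual (lower R' b))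
    (fun a a' => by simp [upper_le_upper, eq_comm]) (fun b b' => by simp [lower_le_lower, eq_comm])
    (fun a b => by simp [lower_le_upper, h]) (fun a b => by simp [not_upper_le_lower])
    (fun t => (eq_lower_or_eq_upper t).symm)
  exact ⟨e.symm⟩

/-- The disjoint union of two posets of rank one. -/
theorem nonempty_sum_orderIso {α β α' β' : Type*} {R : α → β → Prop} {R' : α' → β' → Prop} :
    Nonempty (Bipartite R ⊕ Bipartite R' ≃o
      Bipartite fun (s : α ⊕ α') (t : β ⊕ β') => Sum.LiftRel R R' s t) := by
  refine nonempty_orderIso_of_forall (x := Sum.map (lower R) (lower R'))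
    (y := Sum.map (upper R) (upper R')) ?_ ?_ ?_ ?_ fun t => ?_
  · rintro (a | a) (b | b) <;> simp [lower_le_lower]
  · rintro (a | a) (b | b) <;> simp [upper_le_upper]
  · rintro (a | a) (b | b) <;> simp [lower_le_upper]
  · rintro (a | a) (b | b) <;> simp [not_upper_le_lower]
  · rcases t with t | t <;> rcases eq_lower_or_eq_upper t with ⟨a, rfl⟩ | ⟨b, rfl⟩
    · exact Or.inl ⟨Sum.inl a, rfl⟩
    · exact Or.inr ⟨Sum.inl b, rfl⟩
    · exact Or.inl ⟨Sum.inr a, rfl⟩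
    · exact Or.inr ⟨Sum.inr b, rfl⟩

end Bipartite

/-- Converse of `exists_enum_of_rankSegment`; since the ranks of `x` and `y` are given, isolated
elements do no harm. -/
theorem IsGradedBy.nonempty_rankSegment_orderIso {Q : Type u} [PartialOrder Q] {n : ℕ}
    {rk : Q → ℕ} (h : IsGradedBy Q n rk) {i : ℕ} {α β : Type} {R : α → β → Prop} {x : α → Q}
    {y : β → Q} (hx : Set.BijOn x Set.univ {q | rk q = i})
    (hy : Set.BijOn y Set.univ {q | rk q = i + 1}) (hxy : ∀ a b, x a < y b ↔ R a b) :
    Nonempty (rankSegment Q i (i + 1) ≃o Bipartite R) := by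
  have hmem : ∀ q : Q, q ∈ rankSegment Q i (i + 1) ↔ i ≤ rk q ∧ rk q ≤ i + 1 := by
    intro q
    simp only [rankSegment, Set.mem_ofPred_eq, h.height_eq]
    norm_cast
  have hxr : ∀ a, rk (x a) = i := fun a => hx.mapsTo (Set.mem_univ a)
  have hyr : ∀ b, rk (y b) = i + 1 := fun b => hy.mapsTo (Set.mem_univ b)
  have hxi : Function.Injective x := Set.injOn_univ.1 hx.injOn
  have hyi : Function.Injective y := Set.injOn_univ.1 hy.injOn
  refine Bipartite.nonempty_orderIso_of_forall
    (x := fun a => (⟨x a, (hmem _).2 (by rw [hxr]; omega)⟩ : rankSegment Q i (i + 1)))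
    (y := fun b => ⟨y b, (hmem _).2 (by rw [hyr]; omega)⟩) (fun a a' hle => ?_) (fun b b' hle => ?_)
    (fun a b => ⟨fun hle => ?_, fun hR => ?_⟩) (fun a b hle => ?_) ?_
  · exact hxi (h.eq_of_le hle (by rw [hxr, hxr]))
  · exact hyi (h.eq_of_le hle (by rw [hyr, hyr]))
  · refine (hxy a b).1 (lt_of_le_of_ne hle fun heq => ?_)
    have := congrArg rk heq
    rw [hxr, hyr] at this
    omega
  · exact ((hxy a b).2 hR).le
  · have := h.le_of_le hle
    rw [hxr, hyr] at this
    omega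
  · rintro ⟨q, hq⟩
    rcases (by have := (hmem q).1 hq; omega : rk q = i ∨ rk q = i + 1) with hr | hr
    · obtain ⟨a, -, ha⟩ := hx.surjOn hr
      exact Or.inl ⟨a, Subtype.ext ha⟩
    · obtain ⟨b, -, hb⟩ := hy.surjOn hr
      exact Or.inr ⟨b, Subtype.ext hb⟩

theorem nonempty_twoCrownsA_orderIso :
    Nonempty (Diagram.twoCrownsA.Poset ≃o Crown 2 ⊕ Crown 2) := by
  obtain ⟨e⟩ := Bipartite.nonempty_sum_orderIso (R := fun i j : Fin 2 => i = j ∨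
    (i : ℕ) = ((j : ℕ) + 1) % 2) (R' := fun i j : Fin 2 => i = j ∨ (i : ℕ) = ((j : ℕ) + 1) % 2)
  obtain ⟨e'⟩ := Bipartite.nonempty_orderIso (R := fun i j : Fin 4 => j ∈ Diagram.twoCrownsA i)
    (R' := Sum.LiftRel (fun i j : Fin 2 => i = j ∨ (i : ℕ) = ((j : ℕ) + 1) % 2)
      fun i j : Fin 2 => i = j ∨ (i : ℕ) = ((j : ℕ) + 1) % 2)
    (finSumFinEquiv (m := 2) (n := 2)) (finSumFinEquiv (m := 2) (n := 2)) (by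
      rintro (a | a) (b | b) <;> simp only [Sum.liftRel_inl_inl, Sum.liftRel_inr_inr,
        Sum.not_liftRel_inl_inr, Sum.not_liftRel_inr_inl] <;> revert a b <;> decide)
  exact ⟨e'.trans e.symm⟩

theorem IsEightLayer.of_orderIso {P : Type u} {Q : Type v} [PartialOrder P] [PartialOrder Q]
    (e : P ≃o Q) (hQ : IsEightLayer Q) : IsEightLayer P := by
  have tr : ∀ {T : Type} [PartialOrder T], Nonempty (Q ≃o T) → Nonempty (P ≃o T) :=
    fun ⟨f⟩ => ⟨e.trans f⟩
  exact hQ.imp tr (Or.imp tr (Or.imp tr (Or.imp tr (Or.imp tr (Or.imp tr (Or.imp tr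
    (Or.imp tr tr)))))))

theorem isEightLayer_of_mem_allowedDiagrams {s t : RankLabel} :
    ∀ D ∈ allowedDiagrams s t, IsEightLayer D.Poset := by
  -- Renumberings of the positions that match different drawings of the same poset.
  let swap12 : Equiv.Perm (Fin 4) := ⟨![0, 2, 1, 3], ![0, 2, 1, 3], by decide, by decide⟩
  let swap23 : Equiv.Perm (Fin 4) := ⟨![0, 1, 3, 2], ![0, 1, 3, 2], by decide, by decide⟩
  let cycle : Equiv.Perm (Fin 4) := ⟨![0, 2, 3, 1], ![0, 3, 1, 2], by decide, by decide⟩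
  have h1 : IsEightLayer Diagram.crownA.Poset := Or.inl <|
    Bipartite.nonempty_orderIso (Equiv.refl _) (Equiv.addRight 1) (by decide)
  have h2 : IsEightLayer Diagram.crownB.Poset := Or.inl <|
    Bipartite.nonempty_orderIso swap12 cycle.symm (by decide)
  have h3 : IsEightLayer Diagram.twoCrownsA.Poset :=
    Or.inr <| Or.inl nonempty_twoCrownsA_orderIso
  have h4 : IsEightLayer Diagram.twoCrownsB.Poset := by
    obtain ⟨e⟩ : Nonempty (Diagram.twoCrownsB.Poset ≃o Diagram.twoCrownsA.Poset) :=
      Bipartite.nonempty_orderIso swap12 swap12 (by decide)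
    exact h3.of_orderIso e
  have h5 : IsEightLayer Diagram.twoCrownsC.Poset := by
    obtain ⟨e⟩ : Nonempty (Diagram.twoCrownsC.Poset ≃o Diagram.twoCrownsA.Poset) :=
      Bipartite.nonempty_orderIso cycle.symm swap12 (by decide)
    exact h3.of_orderIso e
  have h6 : IsEightLayer Diagram.almostCompleteA.Poset := Or.inr <| Or.inr <| Or.inl <|
    Bipartite.nonempty_orderIso (Equiv.refl _) (Equiv.refl _) (by decide)
  have h7 : IsEightLayer Diagram.almostCompleteB.Poset := Or.inr <| Or.inr <| Or.inl <|
    Bipartite.nonempty_orderIso (Equiv.refl _) Fin.revPerm (by decide)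
  have h8 : IsEightLayer Diagram.z₁A.Poset :=
    Or.inr <| Or.inr <| Or.inr <| Or.inl ⟨OrderIso.refl _⟩
  have h9 : IsEightLayer Diagram.z₁B.Poset := Or.inr <| Or.inr <| Or.inr <| Or.inl <|
    Bipartite.nonempty_orderIso swap23 (Equiv.refl _) (by decide)
  have h10 : IsEightLayer Diagram.z₁Dual.Poset :=
    Or.inr <| Or.inr <| Or.inr <| Or.inr <| Or.inl <|
      Bipartite.nonempty_orderIso_dual (by decide)
  have h11 : IsEightLayer Diagram.z₂A.Poset :=
    Or.inr <| Or.inr <| Or.inr <| Or.inr <| Or.inr <| Or.inl ⟨OrderIso.refl _⟩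
  have h12 : IsEightLayer Diagram.z₂B.Poset :=
    Or.inr <| Or.inr <| Or.inr <| Or.inr <| Or.inr <| Or.inl <|
      Bipartite.nonempty_orderIso swap23 (Equiv.refl _) (by decide)
  have h13 : IsEightLayer Diagram.z₃.Poset :=
    Or.inr <| Or.inr <| Or.inr <| Or.inr <| Or.inr <| Or.inr <| Or.inl ⟨OrderIso.refl _⟩
  have h14 : IsEightLayer Diagram.z₄.Poset :=
    Or.inr <| Or.inr <| Or.inr <| Or.inr <| Or.inr <| Or.inr <| Or.inr <| Or.inl ⟨OrderIso.refl _⟩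
  have h15 : IsEightLayer Diagram.z₅.Poset :=
    Or.inr <| Or.inr <| Or.inr <| Or.inr <| Or.inr <| Or.inr <| Or.inr <| Or.inr ⟨OrderIso.refl _⟩
  cases s <;> cases t <;>
    simp only [allowedDiagrams, List.forall_mem_cons, List.not_mem_nil, false_imp_iff,
      implies_true, and_true] <;>
    simp only [h1, h2, h3, h4, h5, h6, h7, h8, h9, h10, h11, h12, h13, h14, h15, and_self]

theorem IsGradedBy.isEightLayer {Q : Type u} [PartialOrder Q] {n : ℕ} {rk : Q → ℕ}
    (h : IsGradedBy Q n rk) {i : ℕ} {x y : Fin 4 → Q}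
    (hx : Set.BijOn x Set.univ {q | rk q = i}) (hy : Set.BijOn y Set.univ {q | rk q = i + 1})
    {s t : RankLabel} {D : Diagram} (hD : D ∈ allowedDiagrams s t) (hl : LooksLike x y D) :
    IsEightLayer (rankSegment Q i (i + 1)) := by
  have key : Nonempty (rankSegment Q i (i + 1) ≃o D.Poset) := by
    rcases hl with hl | hl
    · exact h.nonempty_rankSegment_orderIso hx hy hl
    · refine h.nonempty_rankSegment_orderIso (bijOn_comp_perm hx Fin.revPerm)
        (bijOn_comp_perm hy Fin.revPerm) fun a b => ?_
      rw [hl]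
      simp
  obtain ⟨e⟩ := key
  exact (isEightLayer_of_mem_allowedDiagrams D hD).of_orderIso e

/-! ### Enumerations of a level along a fixed-point-free permutation -/

theorem exists_bijOn_of_ncard_eq {Q : Type u} {s : Set Q} {k : ℕ} (hk : k ≠ 0) (hs : s.ncard = k) :
    ∃ x : Fin k → Q, Set.BijOn x Set.univ s := by
  have hfin : s.Finite := Set.finite_of_ncard_ne_zero (by omega)
  have := hfin.to_subtype
  let e : s ≃ Fin k := Finite.equivFinOfCardEq hs
  refine ⟨fun a => e.symm a, fun a _ => (e.symm a).2, fun a _ b _ hab =>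
    e.symm.injective (Subtype.ext hab), fun q hq => ⟨e ⟨q, hq⟩, Set.mem_univ _, by simp⟩⟩

theorem exists_conj_of_bijOn {Q : Type u} {s : Set Q} {f : Q → Q} (hf : Function.Injective f)
    (hfs : ∀ q ∈ s, f q ∈ s) (hfix : ∀ q, f q ≠ q) {k : ℕ} {x : Fin k → Q}
    (hx : Set.BijOn x Set.univ s) :
    ∃ π : Fin k → Fin k, Function.Injective π ∧ (∀ a, π a ≠ a) ∧ ∀ a, f (x a) = x (π a) := by
  choose π hπ using fun a =>
    (hx.surjOn (hfs _ (hx.mapsTo (Set.mem_univ a)))).imp fun b hb => hb.2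
  refine ⟨π, fun a b hab => Set.injOn_univ.1 hx.injOn (hf ?_), fun a ha => hfix (x a) ?_,
    fun a => (hπ a).symm⟩
  · rw [← hπ a, ← hπ b, hab]
  · rw [← hπ a, ha]

theorem bijOn_comp_of_injective {Q : Type u} {s : Set Q} {k : ℕ} {x : Fin k → Q}
    (hx : Set.BijOn x Set.univ s) {ρ : Fin k → Fin k} (hρ : Function.Injective ρ) :
    Set.BijOn (fun a => x (ρ a)) Set.univ s :=
  hx.comp (Set.bijOn_univ.2 (Finite.injective_iff_bijective.1 hρ))

theorem fin_three_derangement : ∀ π : Fin 3 → Fin 3, Function.Injective π → (∀ a, π a ≠ a) →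
    Function.Injective ![0, π 0, π (π 0)] ∧
      ∀ a : Fin 3, π (![0, π 0, π (π 0)] a) = ![0, π 0, π (π 0)] (a + 1) := by
  decide +kernel

/-- A derangement of four points has cycle type 4 or 2 + 2, whence the two labels. The new
enumeration lists the points cycle by cycle, with `c` starting the second transposition. -/
theorem fin_four_derangement : ∀ π : Fin 4 → Fin 4, Function.Injective π → (∀ a, π a ≠ a) →
    (Function.Injective ![0, π 0, π (π 0), π (π (π 0))] ∧
      ∀ a : Fin 4, π (![0, π 0, π (π 0), π (π (π 0))] a) =
        ![0, π 0, π (π 0), π (π (π 0))] (RankLabel.four.perm a)) ∨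
    ∃ c, Function.Injective ![0, π 0, c, π c] ∧
      ∀ a : Fin 4, π (![0, π 0, c, π c] a) = ![0, π 0, c, π c] (RankLabel.twoTwo.perm a) := by
  decide +kernel

theorem exists_enum_three {Q : Type u} {s : Set Q} {f : Q → Q} (hf : Function.Injective f)
    (hfs : ∀ q ∈ s, f q ∈ s) (hfix : ∀ q, f q ≠ q) (hs : s.ncard = 3) :
    ∃ x : Fin 3 → Q, Set.BijOn x Set.univ s ∧ ∀ a, f (x a) = x (a + 1) := by
  obtain ⟨x, hx⟩ := exists_bijOn_of_ncard_eq (by norm_num) hs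
  obtain ⟨π, hπ, hne, hfx⟩ := exists_conj_of_bijOn hf hfs hfix hx
  obtain ⟨hinj, h⟩ := fin_three_derangement π hπ hne
  exact ⟨_, bijOn_comp_of_injective hx hinj, fun a => by rw [hfx, h]⟩

theorem exists_enum_four {Q : Type u} {s : Set Q} {f : Q → Q} (hf : Function.Injective f)
    (hfs : ∀ q ∈ s, f q ∈ s) (hfix : ∀ q, f q ≠ q) (hs : s.ncard = 4) :
    ∃ (t : RankLabel) (x : Fin 4 → Q), Set.BijOn x Set.univ s ∧ ∀ a, f (x a) = x (t.perm a) := by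
  obtain ⟨x, hx⟩ := exists_bijOn_of_ncard_eq (by norm_num) hs
  obtain ⟨π, hπ, hne, hfx⟩ := exists_conj_of_bijOn hf hfs hfix hx
  rcases fin_four_derangement π hπ hne with ⟨hinj, h⟩ | ⟨c, hinj, h⟩
  · exact ⟨.four, _, bijOn_comp_of_injective hx hinj, fun a => by rw [hfx, h]⟩
  · exact ⟨.twoTwo, _, bijOn_comp_of_injective hx hinj, fun a => by rw [hfx, h]⟩

theorem exists_crown_relabeling_of_bool : ∀ p q r : Bool,
    let R : Fin 3 → Fin 3 → Bool := ![![p, q, r], ![r, p, q], ![q, r, p]]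
    (HasTwoNeighbours fun a b => R a b = true) → (∃ a b, R a b = false) →
      ∃ c, ∀ a b : Fin 3, R a (b + c) = true ↔ (a = b ∨ (a : ℕ) = ((b : ℕ) + 1) % 3) := by
  decide +kernel

/-- Invariance makes `R` circulant. With two neighbours everywhere and not all entries true, exactly
two of the three parameters hold, and a cyclic shift of the upper level gives the crown. -/
theorem exists_crown_relabeling (R : Fin 3 → Fin 3 → Bool) (hR : ∀ a b, R (a + 1) (b + 1) = R a b)
    (h2 : HasTwoNeighbours fun a b => R a b = true) (hnf : ∃ a b, R a b = false) :
    ∃ c, ∀ a b : Fin 3, R a (b + c) = true ↔ (a = b ∨ (a : ℕ) = ((b : ℕ) + 1) % 3) := by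
  have h : R 1 0 = R 0 2 ∧ R 1 1 = R 0 0 ∧ R 1 2 = R 0 1 ∧ R 2 0 = R 1 2 ∧ R 2 1 = R 1 0 ∧
      R 2 2 = R 1 1 := ⟨hR 0 2, hR 0 0, hR 0 1, hR 1 2, hR 1 0, hR 1 1⟩
  have hS : R = ![![R 0 0, R 0 1, R 0 2], ![R 0 2, R 0 0, R 0 1], ![R 0 1, R 0 2, R 0 0]] := by
    clear hR h2 hnf
    funext a b
    fin_cases a <;> fin_cases b <;> simp <;> grind
  rw [hS] at h2 hnf ⊢
  exact exists_crown_relabeling_of_bool _ _ _ h2 hnf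

/-! ### Blocks -/

theorem eq_or_eq_of_ncard_eq_two {Q : Type u} [Finite Q] {s : Set Q} (hs : s.ncard = 2) {a b c : Q} (hab : a ≠ b)
    (ha : a ∈ s) (hb : b ∈ s) (hc : c ∈ s) : c = a ∨ c = b := by
  have : ({a, b} : Set Q) = s := Set.eq_of_subset_of_ncard_le
    (by rintro q (rfl | rfl) <;> assumption) (by rw [hs, Set.ncard_pair hab]) (Set.toFinite _)
  rw [← this] at hc
  exact hc

theorem RankLabel.perm_iterate_four (t : RankLabel) (b : Fin 4) :
    t.perm (t.perm (t.perm (t.perm b))) = b := by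
  cases t <;> revert b <;> decide

theorem fin_three_add_one_iterate_four : ∀ a : Fin 3, a + 1 + 1 + 1 + 1 = a + 1 := by
  decide

theorem forall_of_forall_add_one {p : Fin 3 → Prop} (h : ∀ a, p a → p (a + 1)) {a : Fin 3}
    (ha : p a) (b : Fin 3) : p b := by
  have h1 := h _ ha
  have h2 := h _ h1
  have : b = a ∨ b = a + 1 ∨ b = a + 1 + 1 :=
    (by decide : ∀ a b : Fin 3, b = a ∨ b = a + 1 ∨ b = a + 1 + 1) a b
  rcases this with rfl | rfl | rfl <;> assumption

/-- A graded poset with a fixed-point-free automorphism `f`, without irreducible elements and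
without two consecutive levels that are completely related. -/
structure IsBlock (Q : Type u) [PartialOrder Q] (n : ℕ) (rk : Q → ℕ) (f : Q ≃o Q) : Prop where
  graded : IsGradedBy Q n rk
  ne : ∀ q, f q ≠ q
  two_above : ∀ p, rk p < n → ∃ z z', z ≠ z' ∧ p < z ∧ p < z' ∧ rk z = rk p + 1 ∧ rk z' = rk p + 1
  two_below : ∀ p, 0 < rk p →
    ∃ z z', z ≠ z' ∧ z < p ∧ z' < p ∧ rk z + 1 = rk p ∧ rk z' + 1 = rk p
  not_full : ∀ i < n, ∃ p q, rk p = i ∧ rk q = i + 1 ∧ ¬ p < q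
  card_le : ∀ i, {q | rk q = i}.ncard ≤ 4

namespace IsBlock

variable {Q : Type u} [PartialOrder Q] {n : ℕ} {rk : Q → ℕ} {f : Q ≃o Q}

theorem apply_mem_level (h : IsBlock Q n rk f) (i : ℕ) :
    ∀ q ∈ {q | rk q = i}, f q ∈ {q | rk q = i} := fun q hq =>
  (h.graded.apply_orderIso f q).trans hq

theorem one_lt_ncard [Finite Q] (h : IsBlock Q n rk f) (p : Q) : 1 < {q | rk q = rk p}.ncard := by
  rw [Set.one_lt_ncard_iff (Set.toFinite _)]
  exact ⟨f p, p, h.apply_mem_level _ p rfl, rfl, h.ne p⟩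

/-- Two distinct neighbours exhaust a level of size 2, so every pair would be related, contrary to
`not_full`. -/
theorem ncard_ne_two [Finite Q] (h : IsBlock Q n rk f) {i : ℕ} (hi : i < n) :
    {q | rk q = i}.ncard ≠ 2 ∧ {q | rk q = i + 1}.ncard ≠ 2 := by
  obtain ⟨p, q, hp, hq, hpq⟩ := h.not_full i hi
  constructor
  · intro h2
    obtain ⟨z, z', hne, hz, hz', hr, hr'⟩ := h.two_below q (by omega)
    rcases eq_or_eq_of_ncard_eq_two h2 hne (show rk z = i by omega) (show rk z' = i by omega) hp
      with rfl | rfl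
    · exact hpq hz
    · exact hpq hz'
  · intro h2
    obtain ⟨z, z', hne, hz, hz', hr, hr'⟩ := h.two_above p (by omega)
    rcases eq_or_eq_of_ncard_eq_two h2 hne (show rk z = i + 1 by omega)
      (show rk z' = i + 1 by omega) hq with rfl | rfl
    · exact hpq hz
    · exact hpq hz'

theorem hasTwoNeighbours (h : IsBlock Q n rk f) {i : ℕ} (hi : i < n) {α β : Type*} {x : α → Q}
    {y : β → Q} (hx : Set.BijOn x Set.univ {q | rk q = i})
    (hy : Set.BijOn y Set.univ {q | rk q = i + 1}) : HasTwoNeighbours fun a b => x a < y b := by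
  have hxr : ∀ a, rk (x a) = i := fun a => hx.mapsTo (Set.mem_univ a)
  have hyr : ∀ b, rk (y b) = i + 1 := fun b => hy.mapsTo (Set.mem_univ b)
  constructor
  · intro a
    obtain ⟨z, z', hne, hz, hz', hr, hr'⟩ := h.two_above (x a) (by rw [hxr]; exact hi)
    rw [hxr] at hr hr'
    obtain ⟨b, -, rfl⟩ := hy.surjOn hr
    obtain ⟨b', -, rfl⟩ := hy.surjOn hr'
    exact ⟨b, b', fun hbb => hne (congrArg y hbb), hz, hz'⟩
  · intro b
    obtain ⟨z, z', hne, hz, hz', hr, hr'⟩ := h.two_below (y b) (by rw [hyr]; omega)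
    rw [hyr] at hr hr'
    obtain ⟨a, -, rfl⟩ := hx.surjOn (show rk z = i by omega)
    obtain ⟨a', -, rfl⟩ := hx.surjOn (show rk z' = i by omega)
    exact ⟨a, a', fun hbb => hne (congrArg x hbb), hz, hz'⟩

theorem exists_not_lt (h : IsBlock Q n rk f) {i : ℕ} (hi : i < n) {α β : Type*} {x : α → Q}
    {y : β → Q} (hx : Set.BijOn x Set.univ {q | rk q = i})
    (hy : Set.BijOn y Set.univ {q | rk q = i + 1}) : ∃ a b, ¬ x a < y b := by
  obtain ⟨p, q, hp, hq, hpq⟩ := h.not_full i hi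
  obtain ⟨a, -, rfl⟩ := hx.surjOn hp
  obtain ⟨b, -, rfl⟩ := hy.surjOn hq
  exact ⟨a, b, hpq⟩

/-- The fourth power of `f` is the identity on four points and equals the 3-cycle `f` on three.
Hence anything above one of the three points is above all of them. -/
theorem not_three_four (h : IsBlock Q n rk f) {i : ℕ} (hi : i < n) :
    ¬ ({q | rk q = i}.ncard = 3 ∧ {q | rk q = i + 1}.ncard = 4) := by
  rintro ⟨h3, h4⟩
  obtain ⟨x, hx, hfx⟩ := exists_enum_three f.injective (h.apply_mem_level i) h.ne h3
  obtain ⟨t, y, hy, hfy⟩ := exists_enum_four f.injective (h.apply_mem_level (i + 1)) h.ne h4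
  obtain ⟨a, b, hab⟩ := h.exists_not_lt hi hx hy
  obtain ⟨a', -, -, hlt, -⟩ := (h.hasTwoNeighbours hi hx hy).2 b
  refine hab (forall_of_forall_add_one (p := fun a => x a < y b) (fun a ha => ?_) hlt a)
  have := f.strictMono (f.strictMono (f.strictMono (f.strictMono ha)))
  simp only [hfx, hfy, RankLabel.perm_iterate_four] at this
  rwa [fin_three_add_one_iterate_four] at this

theorem not_four_three (h : IsBlock Q n rk f) {i : ℕ} (hi : i < n) :
    ¬ ({q | rk q = i}.ncard = 4 ∧ {q | rk q = i + 1}.ncard = 3) := by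
  rintro ⟨h4, h3⟩
  obtain ⟨t, x, hx, hfx⟩ := exists_enum_four f.injective (h.apply_mem_level i) h.ne h4
  obtain ⟨y, hy, hfy⟩ := exists_enum_three f.injective (h.apply_mem_level (i + 1)) h.ne h3
  obtain ⟨a, b, hab⟩ := h.exists_not_lt hi hx hy
  obtain ⟨b', -, -, hlt, -⟩ := (h.hasTwoNeighbours hi hx hy).1 a
  refine hab (forall_of_forall_add_one (p := fun b => x a < y b) (fun b hb => ?_) hlt b)
  have := f.strictMono (f.strictMono (f.strictMono (f.strictMono hb)))
  simp only [hfx, hfy, RankLabel.perm_iterate_four] at this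
  rwa [fin_three_add_one_iterate_four] at this

theorem ncard_eq [Finite Q] (h : IsBlock Q n rk f) (hn : 1 ≤ n) :
    (∀ i ≤ n, {q | rk q = i}.ncard = 3) ∨ ∀ i ≤ n, {q | rk q = i}.ncard = 4 := by
  have hne : Nonempty Q := by
    obtain ⟨p, -⟩ := h.not_full 0 hn
    exact ⟨p⟩
  have hgt : ∀ i ≤ n, 1 < {q | rk q = i}.ncard := by
    intro i hi
    obtain ⟨p, rfl⟩ := h.graded.exists_rk_eq hi
    exact h.one_lt_ncard p
  have hstep : ∀ i < n, {q | rk q = i + 1}.ncard = {q | rk q = i}.ncard ∧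
      ({q | rk q = i}.ncard = 3 ∨ {q | rk q = i}.ncard = 4) := by
    intro i hi
    have h1 := hgt i hi.le
    have h2 := hgt (i + 1) hi
    have h3 := h.card_le i
    have h4 := h.card_le (i + 1)
    have h5 := h.ncard_ne_two hi
    have h6 := h.not_three_four hi
    have h7 := h.not_four_three hi
    omega
  have hall : ∀ i ≤ n, {q | rk q = i}.ncard = {q | rk q = 0}.ncard := by
    intro i
    induction i with
    | zero => exact fun _ => rfl
    | succ i ih => exact fun hi => ((hstep i hi).1).trans (ih (by omega))
  rcases (hstep 0 hn).2 with h0 | h0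
  · exact Or.inl fun i hi => (hall i hi).trans h0
  · exact Or.inr fun i hi => (hall i hi).trans h0

theorem isSixStack (h : IsBlock Q n rk f) (hn : 1 ≤ n)
    (h3 : ∀ i ≤ n, {q | rk q = i}.ncard = 3) : IsSixStack Q := by
  have hne : Nonempty Q := by
    obtain ⟨p, -⟩ := h.not_full 0 hn
    exact ⟨p⟩
  refine ⟨n, hn, h.graded.isRankedOfRank, fun i hi => ?_⟩
  obtain ⟨x, hx, hfx⟩ := exists_enum_three f.injective (h.apply_mem_level i) h.ne (h3 i hi.le)
  obtain ⟨y, hy, hfy⟩ := exists_enum_three f.injective (h.apply_mem_level (i + 1)) h.ne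
    (h3 (i + 1) hi)
  classical
  obtain ⟨c, hc⟩ := exists_crown_relabeling (fun a b => decide (x a < y b))
    (fun a b => by simp only [← hfx, ← hfy, f.lt_iff_lt])
    (by simpa only [decide_eq_true_eq] using h.hasTwoNeighbours hi hx hy)
    (by simpa only [decide_eq_false_iff_not] using h.exists_not_lt hi hx hy)
  exact h.graded.nonempty_rankSegment_orderIso hx (bijOn_comp_perm hy (Equiv.addRight c))
    fun a b => by simpa only [decide_eq_true_eq, Equiv.coe_addRight] using hc a b

/-- The labels are the cycle types of `f` on the levels. The drawing grows upwards: renumbering only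
the new level leaves the layers already drawn intact, and the invariant that `f` acts by the label's
permutation is carried along. -/
theorem isAdmissibleEightStack (h : IsBlock Q n rk f) (hn : 1 ≤ n)
    (h4 : ∀ i ≤ n, {q | rk q = i}.ncard = 4) : IsAdmissibleEightStack Q := by
  have hne : Nonempty Q := by
    obtain ⟨p, -⟩ := h.not_full 0 hn
    exact ⟨p⟩
  have henum := fun i hi => exists_enum_four f.injective (h.apply_mem_level i) h.ne (h4 i hi)
  obtain ⟨d, hd, hrel⟩ := exists_seq_of_forall_step (n := n)
    (fun i (x : RankLabel × (Fin 4 → Q)) => Set.BijOn x.2 Set.univ {q | rk q = i} ∧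
      ∀ a, f (x.2 a) = x.2 (x.1.perm a))
    (fun i x y => ∃ D ∈ allowedDiagrams x.1 y.1, LooksLike x.2 y.2 D)
    (by
      obtain ⟨t, x, hx⟩ := henum 0 (by omega)
      exact ⟨(t, x), hx⟩)
    (by
      rintro i hi ⟨s, x⟩ ⟨hx, hfx⟩
      change Set.BijOn x _ _ at hx
      change ∀ a, f (x a) = x (s.perm a) at hfx
      obtain ⟨t, y, hy, hfy⟩ := henum (i + 1) hi
      classical
      obtain ⟨π, hπ, D, hD, hl⟩ := exists_looksLike_of_isDrawable
        (isDrawable_of_perm_invariant s t (fun a b => decide (x a < y b))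
          (fun a b => by simp only [← hfx, ← hfy, f.lt_iff_lt])
          (by simpa only [decide_eq_true_eq] using h.hasTwoNeighbours hi hx hy)
          (by simpa only [decide_eq_false_iff_not] using h.exists_not_lt hi hx hy))
        (x := x) (y := y) (fun a b => by simp)
      obtain ⟨hinj, hcomm⟩ := t.relabelings_spec π hπ
      exact ⟨(t, fun b => y (π b)), ⟨bijOn_comp_of_injective hy hinj, fun b => by
        simp only [hfy, hcomm]⟩, D, hD, hl⟩)
  refine ⟨n, ⟨hn, h.graded.isRankedOfRank, fun i hi => ?_⟩, fun i => (d i).1, fun i => (d i).2,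
    fun i => ?_, fun i => hrel i i.2⟩
  · obtain ⟨D, hD, hl⟩ := hrel i hi
    exact h.graded.isEightLayer (hd i hi.le).1 (hd (i + 1) hi).1 hD hl
  · convert (hd i (Nat.lt_succ_iff.1 i.2)).1 using 1
    ext q
    simp [h.graded.height_eq]

end IsBlock

/-! ### Ordinal sums -/

theorem isOrdinalSumOf_of_fibers {C : (Q : Type u) → [PartialOrder Q] → Prop} {P : Type u}
    [PartialOrder P] {k : ℕ} (b : P → Fin k) (hle : ∀ p q, p ≤ q → b p ≤ b q)
    (hlt : ∀ p q, b p < b q → p ≤ q) (hC : ∀ i, C {p // b p = i}) : IsOrdinalSumOf C P := by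
  refine ⟨k, fun i => {p // b p = i}, fun i => inferInstance, hC, ⟨⟨⟨fun p => toLex ⟨b p, p, rfl⟩,
    fun x => x.2.1, fun p => rfl, ?_⟩, ?_⟩⟩⟩
  · rintro ⟨i, p, rfl⟩
    rfl
  · intro p q
    refine Sigma.lex_iff.trans ⟨?_, fun hpq => ?_⟩
    · rintro (h | ⟨h, h'⟩)
      · exact hlt p q h
      -- The indices are generalized so that the transport along their equality can be eliminated.
      · have key : ∀ (i j : Fin k) (hij : i = j) (x : {p // b p = i}) (y : {p // b p = j}),
            hij ▸ x ≤ y → (x : P) ≤ y := by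
          rintro i _ rfl x y hxy
          exact hxy
        exact key _ _ h _ _ h'
    · rcases (hle p q hpq).lt_or_eq with h | h
      · exact Or.inl h
      · have key : ∀ (i j : Fin k) (hij : i = j) (x : {p // b p = i}) (y : {p // b p = j}),
            (x : P) ≤ y → hij ▸ x ≤ y := by
          rintro i _ rfl x y hxy
          exact hxy
        exact Or.inr ⟨h, key _ _ h _ _ hpq⟩

theorem isOrdinalSumOf_self {C : (Q : Type u) → [PartialOrder Q] → Prop} {P : Type u}
    [PartialOrder P] (hP : C P) : IsOrdinalSumOf C P := by
  refine ⟨1, fun _ => P, fun _ => inferInstance, fun _ => hP, ⟨⟨⟨fun p => toLex ⟨0, p⟩,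
    fun x => x.2, fun p => rfl, ?_⟩, ?_⟩⟩⟩
  · rintro ⟨i, p⟩
    obtain rfl : i = 0 := Subsingleton.elim _ _
    rfl
  · intro p q
    refine Sigma.lex_iff.trans ⟨?_, fun hpq => Or.inr ⟨rfl, hpq⟩⟩
    rintro (h | ⟨_, h'⟩)
    · exact absurd h (lt_irrefl _)
    · exact h'

/-! ### Retractions of minimal automorphic posets -/

theorem IsMinimalAutomorphic.eq_univ {P : Type u} [PartialOrder P] (h : IsMinimalAutomorphic P)
    {Q : Set P} {g : P → P} (hg : Monotone g) (hgQ : ∀ p, g p ∈ Q) (hfix : ∀ q ∈ Q, g q = q)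
    (hQ : IsAutomorphic Q) : Q = Set.univ := by
  by_contra hne
  exact h.2 Q ⟨⟨fun p => ⟨g p, hgQ p⟩, fun _ _ hpq => hg hpq⟩, fun q => Subtype.ext (hfix q q.2)⟩
    hne hQ

/-- The restriction of an automorphism to an invariant subset. -/
def OrderIso.restrictSubtype {P : Type u} [PartialOrder P] (f : P ≃o P) (p : P → Prop)
    (hp : ∀ x, p x ↔ p (f x)) : {x // p x} ≃o {x // p x} where
  toEquiv := f.toEquiv.subtypeEquiv hp
  map_rel_iff' := f.le_iff_le

/-- An invariant subset that can be moved away by a retraction is empty. -/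
theorem IsMinimalAutomorphic.eq_empty {P : Type u} [PartialOrder P] (h : IsMinimalAutomorphic P)
    {O : Set P} (hO : ∀ (f : P ≃o P), ∀ x ∈ O, f x ∈ O) {g : P → P} (hg : Monotone g)
    (hgO : ∀ p, g p ∉ O) (hfix : ∀ q, q ∉ O → g q = q) : O = ∅ := by
  obtain ⟨f, hf⟩ := h.1
  -- Stability of the complement uses `hO` for `f.symm` as well as for `f`.
  have hinv : ∀ x, x ∈ Oᶜ ↔ f x ∈ Oᶜ := fun x => not_congr
    ⟨hO f x, fun hx => by simpa using hO f.symm _ hx⟩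
  have := h.eq_univ (Q := Oᶜ) hg hgO hfix
    ⟨f.restrictSubtype (· ∈ Oᶜ) hinv, fun p hp => hf p (congrArg Subtype.val hp)⟩
  simpa using this

/-! ### Covers and isolated levels in minimal automorphic posets -/

namespace IsGradedBy

variable {P : Type u} [PartialOrder P] {r : ℕ} {rk : P → ℕ}

/-- Otherwise the elements of this rank with a unique upper cover form a nonempty set `O` stable
under automorphisms, and sending each to its cover retracts `P` onto the complement. Keeping to one
rank guarantees that the covers lie outside `O`. -/
theorem exists_two_above (h : IsGradedBy P r rk) (hmin : IsMinimalAutomorphic P) (p : P)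
    (hp : rk p < r) :
    ∃ z z', z ≠ z' ∧ p < z ∧ p < z' ∧ rk z = rk p + 1 ∧ rk z' = rk p + 1 := by
  classical
  by_contra hcon
  push Not at hcon
  let O : Set P := {x | rk x = rk p ∧ ∃ z, (x < z ∧ rk z = rk x + 1) ∧
    ∀ w, x < w → rk w = rk x + 1 → w = z}
  have hpO : p ∈ O := by
    obtain ⟨z, hz, hr⟩ := h.exists_gt hp
    refine ⟨rfl, z, ⟨hz, hr⟩, fun w hw hwr => ?_⟩
    by_contra hne
    exact hcon w z hne hw hz hwr hr
  choose c hc using fun x : O => x.2.2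
  have hOf : ∀ (f : P ≃o P), ∀ x ∈ O, f x ∈ O := by
    rintro f x ⟨hx, z, ⟨hz, hr⟩, hu⟩
    refine ⟨by rw [h.apply_orderIso, hx], f z, ⟨f.strictMono hz, ?_⟩, fun w hw hwr => ?_⟩
    · rw [h.apply_orderIso, h.apply_orderIso, hr]
    · rw [← hu (f.symm w) (by rwa [f.lt_symm_apply]) (by
        rw [h.apply_orderIso, hwr, h.apply_orderIso]), f.apply_symm_apply]
  let g : P → P := fun x => if hx : x ∈ O then c ⟨x, hx⟩ else x
  have hg1 : ∀ x (hx : x ∈ O), g x = c ⟨x, hx⟩ := fun x hx => dif_pos hx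
  have hg2 : ∀ x, x ∉ O → g x = x := fun x hx => dif_neg hx
  have hmono : Monotone g := by
    intro x y hxy
    rcases hxy.eq_or_lt with rfl | hlt
    · exact le_rfl
    by_cases hx : x ∈ O
    · have hy : y ∉ O := fun hy => by
        have := h.lt_of_lt hlt
        have := hx.1
        have := hy.1
        omega
      -- Whatever is strictly above `x` is above some cover of `x`, hence above the unique one.
      obtain ⟨z, hxz, hzy, hz⟩ := h.exists_between hlt
      rw [hg1 x hx, hg2 y hy, ← (hc ⟨x, hx⟩).2 z hxz hz]
      exact hzy
    · by_cases hy : y ∈ O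
      · rw [hg2 x hx, hg1 y hy]
        exact hxy.trans (hc ⟨y, hy⟩).1.1.le
      · rwa [hg2 x hx, hg2 y hy]
  have hempty := hmin.eq_empty hOf hmono (fun x => by
    by_cases hx : x ∈ O
    · rw [hg1 x hx]
      intro hcx
      have h1 := (hc ⟨x, hx⟩).1.2
      have h2 := hcx.1
      have h3 := hx.1
      simp only at h1
      omega
    · rwa [hg2 x hx]) hg2
  rw [hempty] at hpO
  exact hpO

theorem exists_two_below (h : IsGradedBy P r rk) (hmin : IsMinimalAutomorphic P) (p : P)
    (hp : 0 < rk p) :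
    ∃ z z', z ≠ z' ∧ z < p ∧ z' < p ∧ rk z + 1 = rk p ∧ rk z' + 1 = rk p := by
  classical
  by_contra hcon
  push Not at hcon
  let O : Set P := {x | rk x = rk p ∧ ∃ z, (z < x ∧ rk z + 1 = rk x) ∧
    ∀ w, w < x → rk w + 1 = rk x → w = z}
  have hpO : p ∈ O := by
    obtain ⟨z, hz, hr⟩ := h.exists_lt hp
    refine ⟨rfl, z, ⟨hz, hr⟩, fun w hw hwr => ?_⟩
    by_contra hne
    exact hcon w z hne hw hz hwr hr
  choose c hc using fun x : O => x.2.2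
  have hOf : ∀ (f : P ≃o P), ∀ x ∈ O, f x ∈ O := by
    rintro f x ⟨hx, z, ⟨hz, hr⟩, hu⟩
    refine ⟨by rw [h.apply_orderIso, hx], f z, ⟨f.strictMono hz, ?_⟩, fun w hw hwr => ?_⟩
    · rw [h.apply_orderIso, h.apply_orderIso, hr]
    · rw [← hu (f.symm w) (by rwa [f.symm_apply_lt]) (by
        rw [h.apply_orderIso, hwr, h.apply_orderIso]), f.apply_symm_apply]
  let g : P → P := fun x => if hx : x ∈ O then c ⟨x, hx⟩ else x
  have hg1 : ∀ x (hx : x ∈ O), g x = c ⟨x, hx⟩ := fun x hx => dif_pos hx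
  have hg2 : ∀ x, x ∉ O → g x = x := fun x hx => dif_neg hx
  have hmono : Monotone g := by
    intro x y hxy
    rcases hxy.eq_or_lt with rfl | hlt
    · exact le_rfl
    by_cases hy : y ∈ O
    · have hx : x ∉ O := fun hx => by
        have := h.lt_of_lt hlt
        have := hx.1
        have := hy.1
        omega
      obtain ⟨z, hxz, hzy, hz⟩ := h.exists_between' hlt
      rw [hg1 y hy, hg2 x hx, ← (hc ⟨y, hy⟩).2 z hzy hz]
      exact hxz
    · by_cases hx : x ∈ O
      · rw [hg2 y hy, hg1 x hx]
        exact (hc ⟨x, hx⟩).1.1.le.trans hxy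
      · rwa [hg2 x hx, hg2 y hy]
  have hempty := hmin.eq_empty hOf hmono (fun x => by
    by_cases hx : x ∈ O
    · rw [hg1 x hx]
      intro hcx
      have h1 := (hc ⟨x, hx⟩).1.2
      have h2 := hcx.1
      have h3 := hx.1
      simp only at h1
      omega
    · rwa [hg2 x hx]) hg2
  rw [hempty] at hpO
  exact hpO

/-- All elements of rank `j` are below all elements of rank `j + 1`. -/
def IsCut (rk : P → ℕ) (j : ℕ) : Prop := ∀ p q : P, rk p = j → rk q = j + 1 → p < q

theorem lt_of_isCut (h : IsGradedBy P r rk) {j : ℕ} (hj : IsCut rk j) {p q : P} (hp : rk p ≤ j)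
    (hq : j < rk q) : p < q := by
  obtain ⟨z, hpz, hz⟩ := h.exists_ge hp (by have := h.le q; omega)
  obtain ⟨w, hwq, hw⟩ := h.exists_le (p := q) (j := j + 1) hq
  exact (hpz.trans_lt (hj z w hz hw)).trans_le hwq

/-- Such a level is a summand of an ordinal sum, so its elements may be moved within it freely.
Collapsing it onto two points `a`, `b` is a retraction, and the image has the fixed-point-free
automorphism that swaps them and acts as `f` elsewhere. -/
theorem ncard_eq_two_of_isCut [Nonempty P] (h : IsGradedBy P r rk) (hmin : IsMinimalAutomorphic P)
    {i : ℕ} (hi : i ≤ r) (hlow : ∀ j, j + 1 = i → IsCut rk j) (hup : i < r → IsCut rk i) :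
    {p | rk p = i}.ncard = 2 := by
  classical
  obtain ⟨f, hf⟩ := id hmin.1
  obtain ⟨a, ha⟩ := h.exists_rk_eq hi
  -- The automorphism only serves to find a second element of the level; it need not preserve `{a,
  -- b}`.
  obtain ⟨b, hb⟩ : ∃ b, b = f a := ⟨_, rfl⟩
  have hab : b ≠ a := hb ▸ hf a
  have hbi : rk b = i := by rw [hb, h.apply_orderIso, ha]
  have hltup : ∀ p q, rk p = i → i < rk q → p < q := fun p q hp hq =>
    h.lt_of_isCut (hup (by have := h.le q; omega)) hp.le hq
  have hltlow : ∀ p q, rk p < i → rk q = i → p < q := fun p q hp hq =>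
    h.lt_of_isCut (j := i - 1) (hlow _ (by omega)) (by omega) (by omega)
  -- Level `i` is comparable with everything of another rank, so a rank-preserving map has to be
  -- checked only off that level.
  have hmono : ∀ g : P → P, (∀ p, rk (g p) = rk p) → (∀ p q, rk p ≠ i → rk q ≠ i → p < q →
      g p < g q) → Monotone g := by
    intro g hg hgi p q hpq
    rcases hpq.eq_or_lt with rfl | hlt
    · exact le_rfl
    have hr := h.lt_of_lt hlt
    by_cases hp : rk p = i
    · exact (hltup _ _ (by rw [hg, hp]) (by rw [hg]; omega)).le
    · by_cases hq : rk q = i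
      · exact (hltlow _ _ (by rw [hg]; omega) (by rw [hg, hq])).le
      · exact (hgi p q hp hq hlt).le
  let Q : Set P := {x | rk x = i → x = a ∨ x = b}
  -- On the rest of level `i` the values are irrelevant and `m e` may fail to be injective; `m e`
  -- and `m e.symm` are inverse to each other only on `Q`.
  let m : (P ≃o P) → P → P := fun e x => if x = a then b else if x = b then a else e x
  have hma : ∀ e, m e a = b := fun e => if_pos rfl
  have hmb : ∀ e, m e b = a := fun e => by simp [m, hab]
  have hm : ∀ e x, rk x ≠ i → m e x = e x := fun e x hx => by
    have h1 : x ≠ a := by rintro rfl; exact hx ha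
    have h2 : x ≠ b := by rintro rfl; exact hx hbi
    simp [m, h1, h2]
  have hmrk : ∀ e x, rk (m e x) = rk x := fun e x => by
    by_cases h1 : x = a
    · rw [h1, hma, hbi, ha]
    · by_cases h2 : x = b
      · rw [h2, hmb, hbi, ha]
      · simp only [m, h1, h2, if_false, h.apply_orderIso]
  have hmmono : ∀ e, Monotone (m e) := fun e => hmono _ (hmrk e) fun p q hp hq hpq => by
    rw [hm e p hp, hm e q hq]
    exact e.strictMono hpq
  have hmQ : ∀ e, ∀ x ∈ Q, m e x ∈ Q := by
    intro e x hx hr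
    rw [hmrk] at hr
    rcases hx hr with rfl | rfl
    · exact Or.inr (hma e)
    · exact Or.inl (hmb e)
  have hminv : ∀ e : P ≃o P, ∀ x ∈ Q, m e.symm (m e x) = x := by
    intro e x hx
    by_cases hr : rk x = i
    · rcases hx hr with rfl | rfl
      · rw [hma, hmb]
      · rw [hmb, hma]
    · rw [hm e x hr, hm _ _ (by rwa [h.apply_orderIso]), e.symm_apply_apply]
  let E : Q ≃ Q :=
    { toFun := fun x => ⟨m f x, hmQ f x x.2⟩
      invFun := fun x => ⟨m f.symm x, hmQ f.symm x x.2⟩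
      left_inv := fun x => Subtype.ext (hminv f x x.2)
      right_inv := fun x => Subtype.ext (hminv f.symm x x.2) }
  have hQ : IsAutomorphic Q := by
    refine ⟨E.toOrderIso (fun x y hxy => hmmono f hxy) (fun x y hxy => hmmono f.symm hxy), ?_⟩
    rintro ⟨x, hx⟩ hfx
    have hfx' : m f x = x := congrArg Subtype.val hfx
    by_cases hr : rk x = i
    · rcases hx hr with rfl | rfl
      · rw [hma] at hfx'
        exact hab hfx'
      · rw [hmb] at hfx'
        exact hab hfx'.symm
    · rw [hm f x hr] at hfx'
      exact hf x hfx'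
  -- The retraction sends the whole level except `a` to `b`.
  let g : P → P := fun x => if rk x = i ∧ x ≠ a then b else x
  have huniv := hmin.eq_univ (Q := Q) (g := g)
    (hmono g (fun p => by by_cases hp : rk p = i ∧ p ≠ a <;> simp [g, hp, hbi])
      fun p q hp hq hpq => by simpa [g, hp, hq] using hpq)
    (fun p hr => by
      by_cases hp : rk p = i ∧ p ≠ a
      · exact Or.inr (if_pos hp)
      · have hgp : g p = p := if_neg hp
        rw [hgp] at hr ⊢
        exact Or.inl (by_contra fun hne => hp ⟨hr, hne⟩))
    (fun q hq => by
      by_cases hp : rk q = i ∧ q ≠ a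
      · rw [(hq hp.1).resolve_left hp.2]
        simp [g]
      · exact if_neg hp) hQ
  have : {p | rk p = i} = {a, b} := by
    ext p
    constructor
    · exact fun hp => (huniv ▸ Set.mem_univ p : p ∈ Q) hp
    · rintro (rfl | rfl)
      · exact ha
      · exact hbi
  rw [this, Set.ncard_pair hab.symm]

end IsGradedBy

/-! ### Decomposition at the cuts -/

open Classical in
/-- The number of cuts below rank `j`. -/
noncomputable def cutCount (F : ℕ → Prop) (j : ℕ) : ℕ := ((Finset.range j).filter F).card

theorem cutCount_zero (F : ℕ → Prop) : cutCount F 0 = 0 := by simp [cutCount]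

theorem cutCount_succ_of_pos {F : ℕ → Prop} {j : ℕ} (h : F j) :
    cutCount F (j + 1) = cutCount F j + 1 := by
  simp [cutCount, Finset.range_add_one, Finset.filter_insert, h]

theorem cutCount_succ_of_neg {F : ℕ → Prop} {j : ℕ} (h : ¬ F j) :
    cutCount F (j + 1) = cutCount F j := by
  simp [cutCount, Finset.range_add_one, Finset.filter_insert, h]

theorem cutCount_mono (F : ℕ → Prop) : Monotone (cutCount F) :=
  monotone_nat_of_le_succ fun j => by
    by_cases h : F j
    · rw [cutCount_succ_of_pos h]
      omega
    · rw [cutCount_succ_of_neg h]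

theorem exists_cut_of_cutCount_lt {F : ℕ → Prop} {j j' : ℕ} (h : cutCount F j < cutCount F j') :
    ∃ l, j ≤ l ∧ l < j' ∧ F l := by
  by_contra hcon
  push Not at hcon
  have hjj : j ≤ j' := by
    by_contra hlt
    have := cutCount_mono F (not_le.1 hlt).le
    omega
  have : ∀ l, j ≤ l → l ≤ j' → cutCount F l = cutCount F j := by
    intro l hl
    induction l, hl using Nat.le_induction with
    | base => exact fun _ => rfl
    | succ l hl ih => exact fun hlj => (cutCount_succ_of_neg (hcon l hl hlj)).trans (ih (by omega))
  have := this j' hjj le_rfl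
  omega

/-- The ranks with a given number of cuts below form an interval between two cuts. -/
theorem exists_interval_of_cutCount (F : ℕ → Prop) (r i : ℕ) (hi : i ≤ cutCount F r) :
    ∃ s e, s ≤ e ∧ e ≤ r ∧ (∀ j ≤ r, cutCount F j = i ↔ s ≤ j ∧ j ≤ e) ∧
      (∀ j, j + 1 = s → F j) ∧ (e < r → F e) ∧ ∀ j, s ≤ j → j < e → ¬ F j := by
  induction r with
  | zero =>
    rw [cutCount_zero] at hi
    refine ⟨0, 0, le_rfl, le_rfl, fun j hj => ?_, by omega, by omega, by omega⟩
    obtain rfl : j = 0 := by omega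
    simp [cutCount_zero]
    omega
  | succ r ih =>
    by_cases hir : i ≤ cutCount F r
    · obtain ⟨s, e, hse, her, hint, hs, he, hno⟩ := ih hir
      by_cases hF : F r
      · have hsucc := cutCount_succ_of_pos hF
        refine ⟨s, e, hse, by omega, fun j hj => ?_, hs, fun _ => ?_, hno⟩
        · rcases Nat.lt_or_eq_of_le hj with hj | rfl
          · exact hint j (by omega)
          · exact iff_of_false (by omega) (by omega)
        · rcases Nat.lt_or_eq_of_le her with her | rfl
          · exact he her
          · exact hF
      · have hsucc := cutCount_succ_of_neg hF
        have hrr := hint r le_rfl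
        -- Without a cut at `r`, the new rank `r + 1` joins the last interval; the other intervals
        -- stay as they are.
        by_cases hier : i = cutCount F r
        · have her' : e = r := by omega
          subst her'
          refine ⟨s, e + 1, by omega, le_rfl, fun j hj => ?_, hs, by omega, fun j hj hje => ?_⟩
          · rcases Nat.lt_or_eq_of_le hj with hj | rfl
            · rw [hint j (by omega)]
              omega
            · exact iff_of_true (by omega) (by omega)
          · rcases Nat.lt_or_eq_of_le (Nat.lt_succ_iff.1 hje) with hj' | rfl
            · exact hno j hj hj'
            · exact hF
        · refine ⟨s, e, hse, by omega, fun j hj => ?_, hs, fun _ => he (by omega), hno⟩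
          rcases Nat.lt_or_eq_of_le hj with hj | rfl
          · exact hint j (by omega)
          · exact iff_of_false (by omega) (by omega)
    -- Here `i` is reached only after a cut at `r`, so its interval consists of `r + 1` alone.
    · have hF : F r := by
        by_contra hF
        rw [cutCount_succ_of_neg hF] at hi
        exact hir hi
      have hsucc := cutCount_succ_of_pos hF
      refine ⟨r + 1, r + 1, le_rfl, le_rfl, fun j hj => ?_, fun j hj => ?_, by omega, by omega⟩
      · rcases Nat.lt_or_eq_of_le hj with hj | rfl
        · have := cutCount_mono F (Nat.lt_succ_iff.1 hj)
          exact iff_of_false (by omega) (by omega)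
        · exact iff_of_true (by omega) (by omega)
      · obtain rfl : j = r := by omega
        exact hF

namespace IsGradedBy

variable {P : Type u} [PartialOrder P] {r : ℕ} {rk : P → ℕ}

/-- The predicate `p` is kept abstract so that the lemma applies directly to the fibres of the cut
count. -/
theorem restrict_interval (h : IsGradedBy P r rk) {s e : ℕ} (her : e ≤ r) {p : P → Prop}
    (hp : ∀ x, p x ↔ s ≤ rk x ∧ rk x ≤ e) :
    IsGradedBy {x // p x} (e - s) fun x => rk x.1 - s where
  lt_of_lt := by
    rintro ⟨x, hx⟩ ⟨y, hy⟩ hxy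
    have := h.lt_of_lt (show x < y from hxy)
    have := (hp x).1 hx
    simp only
    omega
  le := by
    rintro ⟨x, hx⟩
    have := (hp x).1 hx
    simp only
    omega
  exists_between := by
    rintro ⟨x, hx⟩ ⟨y, hy⟩ hxy
    obtain ⟨z, hxz, hzy, hz⟩ := h.exists_between (show x < y from hxy)
    have h1 := (hp x).1 hx
    have h2 := (hp y).1 hy
    have h3 := h.le_of_le hzy
    refine ⟨⟨z, (hp z).2 (by omega)⟩, hxz, hzy, ?_⟩
    simp only
    omega
  exists_gt := by
    rintro ⟨x, hx⟩ hlt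
    have h1 := (hp x).1 hx
    simp only at hlt
    obtain ⟨z, hxz, hz⟩ := h.exists_gt (p := x) (by omega)
    refine ⟨⟨z, (hp z).2 (by omega)⟩, hxz, ?_⟩
    simp only
    omega
  exists_lt := by
    rintro ⟨x, hx⟩ hlt
    have h1 := (hp x).1 hx
    simp only at hlt
    obtain ⟨z, hxz, hz⟩ := h.exists_lt (p := x) (by omega)
    refine ⟨⟨z, (hp z).2 (by omega)⟩, hxz, ?_⟩
    simp only
    omega

theorem ncard_level_le (h : IsGradedBy P r rk) [Finite P] {w : ℕ} (hw : HasWidthAtMost P w)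
    (i : ℕ) : {p | rk p = i}.ncard ≤ w := by
  have hanti : IsAntichain (· ≤ ·) {p | rk p = i} := fun p hp q hq hne hle =>
    hne (h.eq_of_le hle (hq.trans hp.symm).le)
  have := hw _ hanti
  rw [← (Set.toFinite {p | rk p = i}).cast_ncard_eq] at this
  exact_mod_cast this

theorem isBlock_interval [Finite P] (h : IsGradedBy P r rk) (hw : HasWidthAtMost P 4)
    (hmin : IsMinimalAutomorphic P) {f : P ≃o P} (hf : ∀ p, f p ≠ p) {s e : ℕ} (her : e ≤ r)
    (hno : ∀ j, s ≤ j → j < e → ¬ IsCut rk j) {p : P → Prop}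
    (hp : ∀ x, p x ↔ s ≤ rk x ∧ rk x ≤ e) :
    IsBlock {x // p x} (e - s) (fun x => rk x.1 - s)
      (f.restrictSubtype p fun x => by rw [hp, hp, h.apply_orderIso]) where
  graded := h.restrict_interval her hp
  ne := fun x hx => hf x (congrArg Subtype.val hx)
  two_above := by
    rintro ⟨x, hx⟩ hlt
    have h1 := (hp x).1 hx
    simp only at hlt
    obtain ⟨z, z', hne, hz, hz', hr, hr'⟩ := h.exists_two_above hmin x (by omega)
    refine ⟨⟨z, (hp z).2 (by omega)⟩, ⟨z', (hp z').2 (by omega)⟩, ?_, hz, hz', ?_, ?_⟩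
    · simpa using hne
    · simp only
      omega
    · simp only
      omega
  two_below := by
    rintro ⟨x, hx⟩ hlt
    have h1 := (hp x).1 hx
    simp only at hlt
    obtain ⟨z, z', hne, hz, hz', hr, hr'⟩ := h.exists_two_below hmin x (by omega)
    refine ⟨⟨z, (hp z).2 (by omega)⟩, ⟨z', (hp z').2 (by omega)⟩, ?_, hz, hz', ?_, ?_⟩
    · simpa using hne
    · simp only
      omega
    · simp only
      omega
  not_full := by
    intro i hi
    have := hno (s + i) (by omega) (by omega)
    simp only [IsCut, not_forall] at this
    obtain ⟨x, y, hx, hy, hxy⟩ := this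
    refine ⟨⟨x, (hp x).2 (by omega)⟩, ⟨y, (hp y).2 (by omega)⟩, ?_, ?_, hxy⟩
    · simp only
      omega
    · simp only
      omega
  card_le := by
    intro i
    rw [← Set.ncard_image_of_injective _ Subtype.val_injective]
    refine (Set.ncard_le_ncard ?_ (Set.toFinite _)).trans (h.ncard_level_le hw (s + i))
    rintro _ ⟨⟨x, hx⟩, hxi, rfl⟩
    have h1 := (hp x).1 hx
    simp only [Set.mem_ofPred_eq] at hxi ⊢
    omega

/-- The elements between two successive cuts form a two-element antichain or a stack. -/
theorem isSummand_interval [Finite P] [Nonempty P] (h : IsGradedBy P r rk)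
    (hw : HasWidthAtMost P 4) (hmin : IsMinimalAutomorphic P) {s e : ℕ} (hse : s ≤ e) (her : e ≤ r)
    (hs : ∀ j, j + 1 = s → IsCut rk j) (he : e < r → IsCut rk e)
    (hno : ∀ j, s ≤ j → j < e → ¬ IsCut rk j) {p : P → Prop}
    (hp : ∀ x, p x ↔ s ≤ rk x ∧ rk x ≤ e) :
    IsSixTower {x // p x} ∨ IsAdmissibleEightStack {x // p x} := by
  obtain ⟨f, hf⟩ := id hmin.1
  rcases hse.eq_or_lt with rfl | hlt
  · refine Or.inl (isOrdinalSumOf_self (Or.inl ⟨?_, ?_⟩))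
    · rw [← h.ncard_eq_two_of_isCut hmin her hs he]
      change Nat.card {x // p x} = Nat.card {x // rk x = s}
      exact Nat.card_congr (Equiv.subtypeEquivRight fun x => (hp x).trans (by omega))
    · rintro ⟨x, hx⟩ - ⟨y, hy⟩ - hne hle
      have h1 := (hp x).1 hx
      have h2 := (hp y).1 hy
      exact hne (Subtype.ext (h.eq_of_le hle (show rk y ≤ rk x by omega)))
  · have hblock := h.isBlock_interval hw hmin hf her hno hp
    rcases hblock.ncard_eq (by omega) with h3 | h4
    · exact Or.inl (isOrdinalSumOf_self (Or.inr (hblock.isSixStack (by omega) h3)))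
    · exact Or.inr (hblock.isAdmissibleEightStack (by omega) h4)

/-- The summands are the fibres of the number of cuts below the rank: elements with different counts
are separated by a cut and hence comparable, and each fibre is an interval of ranks without inner
cuts. -/
theorem isEightTower [Finite P] [Nonempty P] (h : IsGradedBy P r rk) (hw : HasWidthAtMost P 4)
    (hmin : IsMinimalAutomorphic P) : IsEightTower P := by
  have hlt : ∀ p, cutCount (IsCut rk) (rk p) < cutCount (IsCut rk) r + 1 := fun p =>
    Nat.lt_succ_of_le (cutCount_mono _ (h.le p))
  refine isOrdinalSumOf_of_fibers (fun p => (⟨_, hlt p⟩ : Fin (cutCount (IsCut rk) r + 1)))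
    (fun p q hpq => cutCount_mono _ (h.le_of_le hpq)) (fun p q hpq => ?_) fun i => ?_
  · obtain ⟨l, hpl, hlq, hl⟩ := exists_cut_of_cutCount_lt hpq
    exact (h.lt_of_isCut hl hpl hlq).le
  · obtain ⟨s, e, hse, her, hint, hs, he, hno⟩ :=
      exists_interval_of_cutCount (IsCut rk) r i (Nat.lt_succ_iff.1 i.2)
    exact h.isSummand_interval hw hmin hse her hs he hno fun x => by
      rw [← hint _ (h.le x), Fin.ext_iff]

end IsGradedBy

theorem theorem3p5 :
    (∀ (P : Type u) [PartialOrder P] [Finite P],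
      IsRanked P → HasWidthAtMost P 4 → IsMinimalAutomorphic P → IsEightTower P) ∧
    (∀ (P : Type u) [PartialOrder P] [Finite P], IsEightTower P → IsAutomorphic P) := by
  refine ⟨fun P _ _ ⟨r, hr⟩ hw hmin => ?_, fun P _ _ hP => hP.isAutomorphic⟩
  have := hr.nonempty
  exact hr.isGradedBy.isEightTower hw hmin
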